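/- **Setting.** Let $A,E\in\mathbb C^{n\times n}$, $B\in\mathbb C^{n\times m}$, $C\in\mathbb C^{p\times n}$, $D\in\mathbb C^{p\times m}$ with $n\ge 1$ and $E$ invertible, let $\|\cdot\|$ be the spectral norm, and let $\varepsilon>0$ satisfy $\varepsilon\|D\|<1$. Write $\sigma(M,N)=\{z\in\mathbb C:\det(zN-M)=0\}$, $M(\Delta)=A+B\Delta(I-D\Delta)^{-1}C$, $$\sigma_\varepsilon=\bigcup\{\sigma(M(\Delta),E):\Delta\in\mathbb C^{m\times p},\ \|\Delta\|\le\varepsilon\},\qquad \alpha_\varepsilon=\max_{z\in\sigma_\varepsilon}\operatorname{Re}z,\qquad \rho_\varepsilon=\max_{z\in\sigma_\varepsilon}|z| .$$ Let $G(z)=C(zE-A)^{-1}B+D$, and let $g(z)\in[0,\infty]$ be $\|G(z)\|$, extended to the points of $\sigma(A,E)$ by its limit ($g=\infty$ exactly at the poles of $G$). With $\gamma=\varepsilon^{-1}$, $R=D^*D-\gamma^2I$, $S=DD^*-\gamma^2I$, $\hat A=A-BR^{-1}D^*C$ put $$\mathcal M_x=\begin{bmatrix}\hat A-xE&-\gamma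 BR^{-1}B^*\\ \gamma C^*S^{-1}C&-(\hat A-xE)^*\end{bmatrix},\ \mathcal N=\begin{bmatrix}E&0\\0&E^*\end{bmatrix},\quad \mathcal S_r=\begin{bmatrix}\hat A&-\gamma BR^{-1}B^*\\0&rE^*\end{bmatrix},\ \mathcal T_r=\begin{bmatrix}rE&0\\-\gamma C^*S^{-1}C&\hat A^*\end{bmatrix}.$$ **Selection of eigenvalues.** Let $\Lambda\subseteq\sigma(A,E)$ be chosen by the user so that every eigenvalue left out is uncontrollable ($B^*y=0$ for some $y\neq0$ with $y^*A=\lambda y^*E$) or unobservable ($Cx=0$ for some $x\ne0$ with $Ax=\lambda Ex$), and is not a pole of $G$. **fastSearch.** Let $f_\psi:\mathbb R\to(-\infty,\infty]$ be given for each $\psi\in\mathbb R$. Given $x\in\mathbb R$ and a finite set $\Psi\subset\mathbb R$, run through the $\psi\in\Psi$ in any order; whenever $f_\psi(x)>0$ at the current $x$, replace $x$ by some $r>x$ with $f_\psi(r)=0$ and $f_\psi(r+\mu)<0$ for all sufficiently small $\mu>0$ (any such $r$ is allowed). Return the final $x$. **Algorithm 1 (svsAbscissa)**, with $f_\psi(x)=g(x+\mathrm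 i\psi)-\varepsilon^{-1}$. Choose $\lambda_0\in\Lambda$ of maximal real part and let $\eta_0$ be the result of fastSearch from $\operatorname{Re}\lambda_0$ with $\Psi=\{\operatorname{Im}\lambda_0\}$. While $\eta_k<\alpha_\varepsilon$: let $\Psi$ be the set of midpoints of all intervals $[a,b]$, $a<b$, between consecutive elements of $\{y\in\mathbb R:\mathrm iy\in\sigma(\mathcal M_{\eta_k},\mathcal N)\}$ with $\eta_k+\mathrm i[a,b]\subseteq\sigma_\varepsilon$, and let $\eta_{k+1}$ be the result of fastSearch from $\eta_k$ with $\Psi$. **Algorithm 2 (svsRadius)**, with $f_\psi(r)=g(re^{\mathrm i\psi})-\varepsilon^{-1}$ and a given integer $q\ge1$. Choose $\lambda_0\in\Lambda$ of maximal modulus and let $\eta_0$ be the result of fastSearch from $|\lambda_0|$ with $\Psi$ consisting of $\operatorname{Arg}\lambda_0$ and $q$ random angles. While $\eta_k<\rho_\varepsilon$: let $\Psi$ be the set of midpoints of all intervals $[a,b]$, $a<b$, $a\in[0,2\pi)$, between consecutive elements of the $2\pi$-periodic set $\{\theta\in\mathbb R:e^{\mathrm i\theta}\in\sigma(\mathcal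 S_{\eta_k},\mathcal T_{\eta_k})\}$ with $\eta_ke^{\mathrm i\theta}\in\sigma_\varepsilon$ for all $\theta\in[a,b]$; if there are no such intervals (in particular if the pencil is singular), let $\Psi$ consist of $q$ newly drawn random angles instead; let $\eta_{k+1}$ be the result of fastSearch from $\eta_k$ with $\Psi$. All random angles are independent and uniformly distributed on $[0,2\pi)$. If a loop ends at step $k$, put $\eta_j=\eta_k$ for $j\ge k$. **Theorem.** The maxima $\alpha_\varepsilon$ and $\rho_\varepsilon$ exist. 1. Suppose that for every $\mu\in\sigma(A,E)\setminus\Lambda$ that is an isolated point of $\sigma_\varepsilon$ there is a $w\in\sigma_\varepsilon$ with $\operatorname{Re}w\ge\operatorname{Re}\mu$ that lies in $\Lambda$ or is not isolated in $\sigma_\varepsilon$ (no condition if $\Lambda=\sigma(A,E)$). Then Algorithm 1 can always be started, every step of it can be carried out, and every sequence $(\eta_k)$ it can produce converges to $\alpha_\varepsilon$. 2. Suppose that the same holds with $|w|\ge|\mu|$ in place of $\operatorname{Re}w\ge\operatorname{Re}\mu$. Then, whatever the angles drawn, Algorithm 2 can be started and every step of it can be carried out; and with probability one, every sequence $(\eta_k)$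 it can produce with the angles drawn converges to $\rho_\varepsilon$. -/

import Mathlib

open MeasureTheory ProbabilityTheory Filter Topology
open scoped Matrix Matrix.Norms.L2Operator

noncomputable section

/-- The eigenvalues of the matrix pencil `(M, N)`, i.e. the zeros of `det (z N - M)`. -/
def pencilSpec {ι : Type*} [Fintype ι] [DecidableEq ι] (M N : Matrix ι ι ℂ) : Set ℂ :=
  {z | (z • N - M).det = 0}

/-- The matrices `A, B, C, D, E` of a linear system with input and output. -/
structure LTISystem (n m p : ℕ) where
  A : Matrix (Fin n) (Fin n) ℂ
  B : Matrix (Fin n) (Fin m) ℂ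
  C : Matrix (Fin p) (Fin n) ℂ
  D : Matrix (Fin p) (Fin m) ℂ
  E : Matrix (Fin n) (Fin n) ℂ

/-- `z` is an isolated point of `S`. -/
def IsIsolatedPoint (S : Set ℂ) (z : ℂ) : Prop :=
  ∃ U ∈ 𝓝 z, S ∩ U = {z}

/-- `r` is an admissible answer of the root-finding routine for `f` started at `x₀`. -/
def IsRootToTheRight (f : ℝ → EReal) (x₀ r : ℝ) : Prop :=
  x₀ < r ∧ f r = 0 ∧ ∃ β > 0, ∀ μ ∈ Set.Ioo 0 β, f (r + μ) < 0

/-- `FastSearch f x l x'`: processing the search positions in the list `l` in the given order,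
starting from the estimate `x`, may end with the estimate `x'`. Here `f ψ` is the function whose
roots are sought at position `ψ`. -/
inductive FastSearch (f : ℝ → ℝ → EReal) : ℝ → List ℝ → ℝ → Prop
  | done (x : ℝ) : FastSearch f x [] x
  | skip {x x' ψ : ℝ} {l : List ℝ} :
      ¬ 0 < f ψ x → FastSearch f x l x' → FastSearch f x (ψ :: l) x'
  | root {x r x' ψ : ℝ} {l : List ℝ} :
      0 < f ψ x → IsRootToTheRight (f ψ) x r → FastSearch f r l x' →
        FastSearch f x (ψ :: l) x'

/-- `FastSearch` over a finite set of positions, processed in an arbitrary order. -/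
def FastSearchSet (f : ℝ → ℝ → EReal) (x : ℝ) (Ψ : Set ℝ) (x' : ℝ) : Prop :=
  ∃ l : List ℝ, l.Nodup ∧ (∀ ψ, ψ ∈ l ↔ ψ ∈ Ψ) ∧ FastSearch f x l x'

/-- `[a, b]` is an interval between two consecutive elements of `Y` all of whose points
satisfy `P`. -/
def IsCrossSection (Y : Set ℝ) (P : ℝ → Prop) (a b : ℝ) : Prop :=
  a ∈ Y ∧ b ∈ Y ∧ a < b ∧ (∀ y ∈ Set.Ioo a b, y ∉ Y) ∧ ∀ y ∈ Set.Icc a b, P y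

/-- The point with polar coordinates `(r, θ)`. -/
def polarPt (r θ : ℝ) : ℂ := (r : ℂ) * Complex.exp (θ * Complex.I)

namespace LTISystem

variable {n m p : ℕ} (S : LTISystem n m p)

/-- The perturbed system matrix `A + B Δ (I - D Δ)⁻¹ C`. -/
def pert (Δ : Matrix (Fin m) (Fin p) ℂ) : Matrix (Fin n) (Fin n) ℂ :=
  S.A + S.B * Δ * (1 - S.D * Δ)⁻¹ * S.C

/-- The spectrum of the pencil `(A, E)`. -/
def eig : Set ℂ := pencilSpec S.A S.E

/-- The `ε`-spectral value set; `‖Δ‖` is the spectral norm. -/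
def svs (ε : ℝ) : Set ℂ :=
  {z | ∃ Δ : Matrix (Fin m) (Fin p) ℂ, ‖Δ‖ ≤ ε ∧ z ∈ pencilSpec (S.pert Δ) S.E}

/-- The `ε`-spectral value set abscissa. -/
def abscissa (ε : ℝ) : ℝ := sSup (Complex.re '' S.svs ε)

/-- The `ε`-spectral value set radius. -/
def radius (ε : ℝ) : ℝ := sSup ((fun z : ℂ => ‖z‖) '' S.svs ε)

/-- Observability of `z` as an eigenvalue of `(A, E)`. -/
def IsObservable (z : ℂ) : Prop :=
  ∀ x : Fin n → ℂ, x ≠ 0 → S.A *ᵥ x = z • (S.E *ᵥ x) → S.C *ᵥ x ≠ 0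

/-- Controllability of `z` as an eigenvalue of `(A, E)`. -/
def IsControllable (z : ℂ) : Prop :=
  ∀ y : Fin n → ℂ, y ≠ 0 → star y ᵥ* S.A = z • (star y ᵥ* S.E) → S.Bᴴ *ᵥ y ≠ 0

/-- The transfer function `C (z E - A)⁻¹ B + D`, meaningful for `z ∉ S.eig`. -/
def transfer (z : ℂ) : Matrix (Fin p) (Fin m) ℂ :=
  S.C * (z • S.E - S.A)⁻¹ * S.B + S.D

open Classical in
/-- The spectral norm of the transfer function, extended to the eigenvalues of `(A, E)` by its
limit there: `⊤` at a pole, a finite value where the singularity is removable. -/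
def ntf (z : ℂ) : EReal :=
  if z ∈ S.eig then limsup (fun w : ℂ => ((‖S.transfer w‖ : ℝ) : EReal)) (𝓝[≠] z)
  else ((‖S.transfer z‖ : ℝ) : EReal)

/-- The user's selection `Λ` of eigenvalues of `(A, E)`: only uncontrollable or unobservable
eigenvalues that are not poles of the transfer function may be left out. -/
def IsSelection (Λ : Set ℂ) : Prop :=
  Λ ⊆ S.eig ∧
    ∀ z ∈ S.eig, z ∉ Λ → (¬ S.IsControllable z ∨ ¬ S.IsObservable z) ∧ S.ntf z ≠ ⊤

/-- `R = D* D - γ² I`. -/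
def R (γ : ℝ) : Matrix (Fin m) (Fin m) ℂ := S.Dᴴ * S.D - ((γ ^ 2 : ℝ) : ℂ) • 1

/-- `S = D D* - γ² I`. -/
def Sm (γ : ℝ) : Matrix (Fin p) (Fin p) ℂ := S.D * S.Dᴴ - ((γ ^ 2 : ℝ) : ℂ) • 1

/-- The matrix `𝓜` of the pencil of the vertical search. -/
def contM (γ x : ℝ) : Matrix (Fin n ⊕ Fin n) (Fin n ⊕ Fin n) ℂ :=
  Matrix.fromBlocks
    (S.A - (x : ℂ) • S.E - S.B * (S.R γ)⁻¹ * S.Dᴴ * S.C)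
    (-((γ : ℂ) • (S.B * (S.R γ)⁻¹ * S.Bᴴ)))
    ((γ : ℂ) • (S.Cᴴ * (S.Sm γ)⁻¹ * S.C))
    (-(S.A - (x : ℂ) • S.E - S.B * (S.R γ)⁻¹ * S.Dᴴ * S.C)ᴴ)

/-- The matrix `𝓝` of the pencil of the vertical search. -/
def contN : Matrix (Fin n ⊕ Fin n) (Fin n ⊕ Fin n) ℂ :=
  Matrix.fromBlocks S.E 0 0 S.Eᴴ

/-- The matrix `𝓢` of the pencil of the circular search. -/
def discS (γ r : ℝ) : Matrix (Fin n ⊕ Fin n) (Fin n ⊕ Fin n) ℂ :=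
  Matrix.fromBlocks
    (S.A - S.B * (S.R γ)⁻¹ * S.Dᴴ * S.C)
    (-((γ : ℂ) • (S.B * (S.R γ)⁻¹ * S.Bᴴ)))
    0
    ((r : ℂ) • S.Eᴴ)

/-- The matrix `𝓣` of the pencil of the circular search. -/
def discT (γ r : ℝ) : Matrix (Fin n ⊕ Fin n) (Fin n ⊕ Fin n) ℂ :=
  Matrix.fromBlocks
    ((r : ℂ) • S.E)
    0
    (-((γ : ℂ) • (S.Cᴴ * (S.Sm γ)⁻¹ * S.C)))
    (S.Aᴴ - S.Cᴴ * S.D * (S.R γ)⁻¹ * S.Bᴴ)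

/-! ### The abscissa algorithm -/

/-- The function whose roots are sought on the horizontal line `Im z = y`. -/
def horizFun (ε y x : ℝ) : EReal := S.ntf (x + y * Complex.I) - ((ε⁻¹ : ℝ) : EReal)

/-- The `y` such that `i y` is an eigenvalue of the vertical-search pencil at `x`. -/
def vertEigs (ε x : ℝ) : Set ℝ :=
  {y | (y : ℂ) * Complex.I ∈ pencilSpec (S.contM ε⁻¹ x) S.contN}

/-- The midpoints of the cross sections found by the vertical search at `x`. -/
def vertMidpoints (ε x : ℝ) : Set ℝ :=
  {ψ | ∃ a b, IsCrossSection (S.vertEigs ε x)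
    (fun y => (x + y * Complex.I : ℂ) ∈ S.svs ε) a b ∧ ψ = (a + b) / 2}

/-- `x` is a possible estimate of the abscissa algorithm on entering its loop. -/
def AbsInit (ε : ℝ) (Λ : Set ℂ) (x : ℝ) : Prop :=
  ∃ z₀ ∈ Λ, (∀ z ∈ Λ, z.re ≤ z₀.re) ∧ FastSearchSet (S.horizFun ε) z₀.re {z₀.im} x

/-- One pass of the loop of the abscissa algorithm (once the loop condition fails, the estimate
is kept). -/
def AbsStep (ε x x' : ℝ) : Prop :=
  (x < S.abscissa ε → FastSearchSet (S.horizFun ε) x (S.vertMidpoints ε x) x') ∧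
    (¬ x < S.abscissa ε → x' = x)

/-- The estimates `η 0, η 1, …` are produced by an execution of the abscissa algorithm. -/
def IsAbsRun (ε : ℝ) (Λ : Set ℂ) (η : ℕ → ℝ) : Prop :=
  S.AbsInit ε Λ (η 0) ∧ ∀ k, S.AbsStep ε (η k) (η (k + 1))

/-! ### The radius algorithm -/

/-- The function whose roots are sought on the ray with angle `θ`. -/
def radFun (ε θ r : ℝ) : EReal := S.ntf (polarPt r θ) - ((ε⁻¹ : ℝ) : EReal)

/-- The angles `θ` (all real representatives) such that `exp (i θ)` is an eigenvalue of the
circular-search pencil at radius `r`. -/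
def circEigs (ε r : ℝ) : Set ℝ :=
  {θ | Complex.exp (θ * Complex.I) ∈ pencilSpec (S.discS ε⁻¹ r) (S.discT ε⁻¹ r)}

/-- The midpoints of the arcs found by the circular search at radius `r`. As `circEigs` is
`2π`-periodic, the wrap-around arc is included. If the pencil is singular, `circEigs` is all of
`ℝ` and no arc is found. -/
def circMidpoints (ε r : ℝ) : Set ℝ :=
  {ψ | ∃ a ∈ Set.Ico 0 (2 * Real.pi), ∃ b, IsCrossSection (S.circEigs ε r)
    (fun θ => polarPt r θ ∈ S.svs ε) a b ∧ ψ = (a + b) / 2}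

open Classical in
/-- The search directions used at radius `r`: the midpoints of the arcs if there are any, and
otherwise the randomly drawn angles `φ`. -/
def radDirections (ε : ℝ) {q : ℕ} (φ : Fin q → ℝ) (r : ℝ) : Set ℝ :=
  if S.circMidpoints ε r = ∅ then Set.range φ else S.circMidpoints ε r

/-- `x` is a possible estimate of the radius algorithm on entering its loop, if the random angles
drawn before are `φ`. -/
def RadInit (ε : ℝ) (Λ : Set ℂ) {q : ℕ} (φ : Fin q → ℝ) (x : ℝ) : Prop :=
  ∃ z₀ ∈ Λ, (∀ z ∈ Λ, ‖z‖ ≤ ‖z₀‖) ∧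
    FastSearchSet (S.radFun ε) ‖z₀‖ (insert z₀.arg (Set.range φ)) x

/-- One pass of the loop of the radius algorithm, with random angles `φ`. -/
def RadStep (ε : ℝ) {q : ℕ} (φ : Fin q → ℝ) (x x' : ℝ) : Prop :=
  (x < S.radius ε → FastSearchSet (S.radFun ε) x (S.radDirections ε φ x) x') ∧
    (¬ x < S.radius ε → x' = x)

/-- The estimates `η 0, η 1, …` are produced by an execution of the radius algorithm in which the
angles drawn are `φ 0` initially and `φ (k + 1)` in the `k`-th pass of the loop. -/
def IsRadRun (ε : ℝ) (Λ : Set ℂ) {q : ℕ} (φ : ℕ → Fin q → ℝ) (η : ℕ → ℝ) : Prop :=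
  S.RadInit ε Λ (φ 0) (η 0) ∧ ∀ k, S.RadStep ε (φ (k + 1)) (η k) (η (k + 1))

end LTISystem

end

/-! Write g for `S.ntf` and γ = ε⁻¹. A determinant identity shows that `S.svs ε` is `S.eig` together
with {g ≥ γ} (`mem_svs_iff`). Since g is continuous and below γ outside a disc, this set is compact
and the maxima exist. Both pencils come from one determinant `svDet`, polynomial in z, z̄ and s.
Eliminating the states shows that it vanishes at s = g(z)² when g(z) is positive and finite;
eliminating the inputs turns it, at s = γ², into the pencils. So the search finds every point of the
line or circle where g = γ, and possibly further points.

The estimates increase and stay below the maximum, so they have a limit η'. Suppose η' is smaller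
than the maximum. Up to a dominated isolated eigenvalue, the maximum is attained in Λ, which the
starting value excludes, or at a point with g ≥ γ. By the maximum principle that point lies in the
closure of {g > γ}, and every component of {g > γ} contains a pole of G, hence an element of Λ. By
connectedness {g > γ} meets the line or circle at η', and so contains a small box around some point
there.

A late search therefore finds a gap between consecutive eigenvalues on which g > γ. If the gap lies
in the box, its midpoint would carry the estimate past η'. Otherwise its length is bounded below
(`IsClosed.exists_consecutive_near`), and the midpoint must be blocked, that is, g ≤ γ somewhere on
its search path before η'. This cannot happen infinitely often (`not_frequently_blocked`). In the
limit interval, choose positions on both sides of the midpoint where g avoids γ just left of η'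
(`exists_generic`). Then {g ≤ γ} would have to begin inside a box three sides of which lie in {g >
γ}, and just before it begins, g has interior local minima along the search line with values
slightly above γ. But such values satisfy a nontrivial relation e(x, σ²) = 0
(`exists_ne_zero_of_isLocalMin`), which after removal of the factor s - γ² has no solution near s =
γ² for x just left of η' (`exists_lt_of_boundary_lt`).

On circles there may be no arcs, for instance when the pencil is singular. If arcs are eventually
never found, the second Borel–Cantelli lemma provides a random angle in the box around the point at
radius η'. -/

/-! ### Subtracting a real number in `EReal` -/

theorem EReal.zero_lt_sub_coe_iff (a : EReal) (c : ℝ) : 0 < a - (c : EReal) ↔ (c : EReal) < a := by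
  induction a with
  | bot => simp
  | top => simp
  | coe a => norm_cast; exact _root_.sub_pos

theorem EReal.sub_coe_lt_zero_iff (a : EReal) (c : ℝ) : a - (c : EReal) < 0 ↔ a < (c : EReal) := by
  induction a with
  | bot => simp
  | top => simp
  | coe a => norm_cast; exact _root_.sub_neg

theorem EReal.sub_coe_eq_zero_iff (a : EReal) (c : ℝ) : a - (c : EReal) = 0 ↔ a = (c : EReal) := by
  induction a with
  | bot => simp
  | top => simp
  | coe a => norm_cast; exact _root_.sub_eq_zero

/-! ### The search routine -/

/-- Since the root taken is arbitrary, the convergence proof uses only these three facts. The last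
one holds because a direction is either skipped at a point where its function is not positive, or
moves the estimate to a root. -/
theorem FastSearch.spec {f : ℝ → ℝ → EReal} {x x' : ℝ} {l : List ℝ} (h : FastSearch f x l x') :
    x ≤ x' ∧ (x' = x ∨ ∃ ψ ∈ l, f ψ x' = 0) ∧ ∀ ψ ∈ l, ∃ t ∈ Set.Icc x x', ¬ 0 < f ψ t := by
  induction h with
  | done x => simp
  | @skip x x' ψ l h0 _ ih =>
    obtain ⟨h1, h2, h3⟩ := ih
    refine ⟨h1, h2.imp id fun ⟨φ, hφ, e⟩ => ⟨φ, List.mem_cons_of_mem _ hφ, e⟩, ?_⟩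
    intro φ hφ
    rcases List.mem_cons.1 hφ with rfl | hφ
    · exact ⟨x, ⟨le_rfl, h1⟩, h0⟩
    · exact h3 φ hφ
  | @root x r x' ψ l _ hr _ ih =>
    obtain ⟨h1, h2, h3⟩ := ih
    refine ⟨hr.1.le.trans h1, Or.inr ?_, ?_⟩
    · rcases h2 with rfl | ⟨φ, hφ, e⟩
      · exact ⟨ψ, List.mem_cons_self, hr.2.1⟩
      · exact ⟨φ, List.mem_cons_of_mem _ hφ, e⟩
    · intro φ hφ
      rcases List.mem_cons.1 hφ with rfl | hφ
      · exact ⟨r, ⟨hr.1.le, h1⟩, by simp [hr.2.1]⟩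
      · obtain ⟨t, ht, e⟩ := h3 φ hφ
        exact ⟨t, ⟨hr.1.le.trans ht.1, ht.2⟩, e⟩

theorem FastSearchSet.spec {f : ℝ → ℝ → EReal} {x x' : ℝ} {Ψ : Set ℝ}
    (h : FastSearchSet f x Ψ x') :
    x ≤ x' ∧ (x' = x ∨ ∃ ψ ∈ Ψ, f ψ x' = 0) ∧ ∀ ψ ∈ Ψ, ∃ t ∈ Set.Icc x x', ¬ 0 < f ψ t := by
  obtain ⟨l, -, hl, h⟩ := h
  simpa only [hl] using h.spec

theorem FastSearch.exists_of_roots {f : ℝ → ℝ → EReal}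
    (hf : ∀ ψ x, 0 < f ψ x → ∃ r, IsRootToTheRight (f ψ) x r) (l : List ℝ) (x : ℝ) :
    ∃ x', FastSearch f x l x' := by
  induction l generalizing x with
  | nil => exact ⟨x, .done x⟩
  | cons ψ l ih =>
    by_cases h : 0 < f ψ x
    · obtain ⟨r, hr⟩ := hf ψ x h
      obtain ⟨x', hx'⟩ := ih r
      exact ⟨x', .root h hr hx'⟩
    · obtain ⟨x', hx'⟩ := ih x
      exact ⟨x', .skip h hx'⟩

theorem FastSearchSet.exists_of_roots {f : ℝ → ℝ → EReal}
    (hf : ∀ ψ x, 0 < f ψ x → ∃ r, IsRootToTheRight (f ψ) x r) {Ψ : Set ℝ} (hΨ : Ψ.Finite)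
    (x : ℝ) : ∃ x', FastSearchSet f x Ψ x' := by
  obtain ⟨x', hx'⟩ := FastSearch.exists_of_roots hf hΨ.toFinset.toList x
  exact ⟨x', _, Finset.nodup_toList _, by simp, hx'⟩

/-- The last point at which `u ≥ c` serves: beyond it `u < c`, so continuity forces equality there.
-/
theorem exists_isRootToTheRight {u : ℝ → EReal} (hu : Continuous u) {c x₀ M : ℝ}
    (h₀ : (c : EReal) < u x₀) (hM : ∀ x ≥ M, u x < c) :
    ∃ r, IsRootToTheRight (fun x => u x - (c : EReal)) x₀ r := by
  set T : Set ℝ := {x | x₀ ≤ x ∧ (c : EReal) ≤ u x} with hT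
  have hcl : IsClosed T := isClosed_Ici.inter (isClosed_Ici.preimage hu)
  have hne : T.Nonempty := ⟨x₀, le_rfl, h₀.le⟩
  have hbd : BddAbove T := ⟨M, fun x hx => not_lt.1 fun h => (hM x h.le).not_ge hx.2⟩
  have hr := hcl.csSup_mem hne hbd
  set r := sSup T with hrdef
  have hafter : ∀ x, r < x → u x < c := fun x hx => by
    by_contra h
    exact (le_csSup hbd (show x ∈ T from ⟨hr.1.trans hx.le, not_lt.1 h⟩)).not_gt hx
  have hle : u r ≤ c := by
    have h1 : Tendsto u (𝓝[>] r) (𝓝 (u r)) := (hu.tendsto r).mono_left nhdsWithin_le_nhds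
    exact le_of_tendsto h1 (by filter_upwards [self_mem_nhdsWithin] with x hx using (hafter x hx).le)
  have heq : u r = c := le_antisymm hle hr.2
  refine ⟨r, ?_, (EReal.sub_coe_eq_zero_iff _ _).2 heq, 1, one_pos, fun μ hμ =>
    (EReal.sub_coe_lt_zero_iff _ _).2 (hafter _ (by linarith [hμ.1]))⟩
  refine lt_of_le_of_ne hr.1 fun h => ?_
  rw [h, heq] at h₀
  exact lt_irrefl _ h₀

/-! ### Consecutive elements of a closed set of real numbers -/

theorem IsClosed.exists_consecutive {Y : Set ℝ} (hY : IsClosed Y) {y₀ u v : ℝ} (h₀ : y₀ ∉ Y)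
    (hu : u ∈ Y) (hv : v ∈ Y) (huy : u ≤ y₀) (hyv : y₀ ≤ v) :
    ∃ c ∈ Y, ∃ d ∈ Y, c < y₀ ∧ y₀ < d ∧ u ≤ c ∧ d ≤ v ∧ ∀ y ∈ Set.Ioo c d, y ∉ Y := by
  have hc := (hY.inter (isClosed_Iic (a := y₀))).csSup_mem ⟨u, hu, huy⟩ ⟨y₀, fun x hx => hx.2⟩
  have hd := (hY.inter (isClosed_Ici (a := y₀))).csInf_mem ⟨v, hv, hyv⟩ ⟨y₀, fun x hx => hx.2⟩
  refine ⟨_, hc.1, _, hd.1, lt_of_le_of_ne hc.2 fun h => h₀ (h ▸ hc.1),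
    lt_of_le_of_ne hd.2 fun h => h₀ (h ▸ hd.1), le_csSup ⟨y₀, fun x hx => hx.2⟩ ⟨hu, huy⟩,
    csInf_le ⟨y₀, fun x hx => hx.2⟩ ⟨hv, hyv⟩, fun y hy hyY => ?_⟩
  rcases le_total y y₀ with h | h
  · exact (le_csSup ⟨y₀, fun x hx => hx.2⟩ (show y ∈ Y ∩ Set.Iic y₀ from ⟨hyY, h⟩)).not_gt hy.1
  · exact (csInf_le ⟨y₀, fun x hx => hx.2⟩ (show y ∈ Y ∩ Set.Ici y₀ from ⟨hyY, h⟩)).not_gt hy.2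

/-- A continuous function that avoids the value `c` on an interval and exceeds it at one point
exceeds it on the whole interval. -/
theorem lt_on_of_ne {X : Type*} [TopologicalSpace X] {u : X → EReal} {s : Set X}
    (hs : IsPreconnected s) (hu : ContinuousOn u s) {c : EReal} (hne : ∀ y ∈ s, u y ≠ c)
    {y₀ : X} (hy₀ : y₀ ∈ s) (h₀ : c < u y₀) : ∀ y ∈ s, c < u y := by
  intro y hy
  by_contra h
  obtain ⟨z, hz, e⟩ := hs.intermediate_value hy hy₀ hu ⟨not_lt.1 h, h₀.le⟩
  exact hne z hz e

/-! ### ### Algebraic functions have few local minima -/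

/-- Generic squarefree part: a polynomial with coefficients in a domain of characteristic zero has
the same zeros as one with simple zeros only, for all specializations of the coefficients outside
the zero set of a nonzero `e`. -/
theorem Polynomial.exists_simple_zeros {R F : Type*} [CommRing R] [IsDomain R] [CharZero R]
    [Field F] {P : Polynomial R} (hP : P ≠ 0) :
    ∃ (Q : Polynomial R) (e : R), e ≠ 0 ∧ ∀ (φ : R →+* F) (y : F), φ e ≠ 0 →
      (P.eval₂ φ y = 0 → Q.eval₂ φ y = 0) ∧
        (Q.eval₂ φ y = 0 → Q.derivative.eval₂ φ y ≠ 0) := by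
  classical
  let K := FractionRing R
  let ι : Polynomial R →+* Polynomial K := Polynomial.mapRingHom (algebraMap R K)
  have hι : Function.Injective ι := Polynomial.map_injective _ (IsFractionRing.injective R K)
  have hιC : ∀ c : R, ι (Polynomial.C c) = Polynomial.C (algebraMap R K c) :=
    fun c => Polynomial.map_C _
  have clear : ∀ f : Polynomial K, ∃ (c : R) (g : Polynomial R), c ≠ 0 ∧
      ι g = ι (Polynomial.C c) * f := by
    intro f
    obtain ⟨b, hb, h⟩ := IsLocalization.integerNormalization_spec (nonZeroDivisors R) f
    refine ⟨b, _, nonZeroDivisors.ne_zero hb, h.trans ?_⟩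
    rw [hιC, ← Polynomial.smul_eq_C_mul, algebraMap_smul]
  have hιP : ι P ≠ 0 := (map_ne_zero_iff ι hι).2 hP
  have : CharZero K := IsFractionRing.charZero R
  set r := UniqueFactorizationMonoid.radical (ι P) with hr
  obtain ⟨a, b, hab⟩ : r.Separable :=
    PerfectField.separable_iff_squarefree.2 UniqueFactorizationMonoid.squarefree_radical
  obtain ⟨N, k, hk⟩ := UniqueFactorizationMonoid.exists_dvd_radical_self_pow hιP
  obtain ⟨c, Q, hc, hQ⟩ := clear r
  obtain ⟨α, a', hα, ha'⟩ := clear a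
  obtain ⟨β, b', hβ, hb'⟩ := clear b
  obtain ⟨κ, k', hκ, hk'⟩ := clear k
  have hQ' : ι Q.derivative = ι (Polynomial.C c) * r.derivative := by
    have h1 : ι Q.derivative = (ι Q).derivative := (Polynomial.derivative_map Q _).symm
    rw [h1, hQ, hιC, Polynomial.derivative_C_mul]
  have id1 : Polynomial.C β * a' * Q + Polynomial.C α * b' * Q.derivative =
      Polynomial.C (α * β * c) := by
    apply hι
    simp only [map_add, map_mul, hQ, hQ', ha', hb']
    linear_combination ι (Polynomial.C α) * ι (Polynomial.C β) * ι (Polynomial.C c) * hab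
  have id2 : Polynomial.C κ * Q ^ N = Polynomial.C c ^ N * P * k' := by
    apply hι
    simp only [map_mul, map_pow, hQ, hk', mul_pow]
    rw [← hr] at hk
    rw [hk]; ring
  refine ⟨Q, α * β * c * κ, by simp [hα, hβ, hc, hκ], fun φ y he => ⟨fun h => ?_, fun h h' => ?_⟩⟩
  · have := congrArg (Polynomial.eval₂ φ y) id2
    simp only [Polynomial.eval₂_mul, Polynomial.eval₂_pow, h, Polynomial.eval₂_C, mul_zero,
      zero_mul] at this
    rw [map_mul] at he
    exact eq_zero_of_pow_eq_zero ((mul_eq_zero.1 this).resolve_left (right_ne_zero_of_mul he))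
  · have := congrArg (Polynomial.eval₂ φ y) id1
    simp only [Polynomial.eval₂_mul, Polynomial.eval₂_add, h, h', Polynomial.eval₂_C, mul_zero,
      add_zero] at this
    rw [map_mul] at he
    exact left_ne_zero_of_mul he this.symm

/-- A continuous function given by simple zeros of a smooth family has no local minimum. -/
theorem not_isLocalMin_of_simple_zeros {Φ Φ' : ℝ → ℝ → ℂ}
    (hΦ' : Continuous (Function.uncurry Φ'))
    (hd : ∀ y s, HasDerivAt (fun y => Φ y s) (Φ' y s) y) {u : ℝ → ℝ} {y₀ : ℝ}
    (h₀ : Φ' y₀ (u y₀) ≠ 0) (hu : ∀ᶠ y in 𝓝 y₀, ContinuousAt u y)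
    (hz : ∀ᶠ y in 𝓝 y₀, Φ y (u y) = 0) : ¬ IsLocalMin u y₀ := by
  intro hmin
  -- Multiplication by this conjugate makes the real part of the `y`-derivative positive at the base
  -- point, hence nearby.
  set c : ℂ := starRingEnd ℂ (Φ' y₀ (u y₀)) with hc
  have hq0 : 0 < (c * Φ' y₀ (u y₀)).re := by
    rw [hc, mul_comm, Complex.mul_conj]
    simpa using Complex.normSq_pos.2 h₀
  have hopen : ∀ᶠ z : ℝ × ℝ in 𝓝 (y₀, u y₀), 0 < (c * Φ' z.1 z.2).re := by
    have hcont : Continuous fun z : ℝ × ℝ => (c * Φ' z.1 z.2).re :=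
      Complex.continuous_re.comp (continuous_const.mul hΦ')
    exact hcont.continuousAt.eventually (lt_mem_nhds hq0)
  rw [nhds_prod_eq] at hopen
  obtain ⟨p₁, h₁, p₂, h₂, hp⟩ := eventually_prod_iff.1 hopen
  have hall := (h₁.and ((hu.self_of_nhds.eventually h₂).and (hu.and (hz.and hmin))))
  obtain ⟨a, ha, hball⟩ := Metric.eventually_nhds_iff_ball.1 hall
  have hmem : ∀ y ∈ Set.Icc (y₀ - a / 2) (y₀ + a / 2), y ∈ Metric.ball y₀ a := fun y hy => by
    rw [Metric.mem_ball, Real.dist_eq, abs_lt]; constructor <;> linarith [hy.1, hy.2]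
  -- If `u` takes the value `s` at two points, then `Re (c Φ(·, s))` vanishes at both although it is
  -- strictly increasing. So `u` is injective, and being continuous it is strictly monotone.
  have hinj : Set.InjOn u (Set.Icc (y₀ - a / 2) (y₀ + a / 2)) := by
    intro y₁ hy₁ y₂ hy₂ he
    have hmono : StrictMonoOn (fun y => (c * Φ y (u y₁)).re)
        (Set.Icc (y₀ - a / 2) (y₀ + a / 2)) := by
      have hder : ∀ y, HasDerivAt (fun y => (c * Φ y (u y₁)).re) (c * Φ' y (u y₁)).re y :=
        fun y => Complex.reCLM.hasFDerivAt.comp_hasDerivAt y ((hd y (u y₁)).const_mul c)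
      refine strictMonoOn_of_deriv_pos (convex_Icc _ _)
        (fun y _ => (hder y).continuousAt.continuousWithinAt) fun y hy => ?_
      rw [(hder y).deriv]
      rw [interior_Icc] at hy
      exact hp (hball y (hmem y (Set.Ioo_subset_Icc_self hy))).1 (hball _ (hmem _ hy₁)).2.1
    refine hmono.injOn hy₁ hy₂ ?_
    have e1 := (hball _ (hmem _ hy₁)).2.2.2.1
    have e2 := (hball _ (hmem _ hy₂)).2.2.2.1
    rw [← he] at e2
    simp only [e1, e2]
  have hcont : ContinuousOn u (Set.Icc (y₀ - a / 2) (y₀ + a / 2)) :=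
    fun y hy => (hball y (hmem y hy)).2.2.1.continuousWithinAt
  have m1 : y₀ - a / 2 ∈ Set.Icc (y₀ - a / 2) (y₀ + a / 2) := ⟨le_rfl, by linarith⟩
  have m2 : y₀ + a / 2 ∈ Set.Icc (y₀ - a / 2) (y₀ + a / 2) := ⟨by linarith, le_rfl⟩
  have m0 : y₀ ∈ Set.Icc (y₀ - a / 2) (y₀ + a / 2) := ⟨by linarith, by linarith⟩
  rcases hcont.strictMonoOn_of_injOn_Icc' (by linarith) hinj with h | h
  · exact (h m1 m0 (by linarith)).not_ge (hball _ (hmem _ m1)).2.2.2.2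
  · exact (h m0 m2 (by linarith)).not_ge (hball _ (hmem _ m2)).2.2.2.2

theorem Polynomial.continuous_evalEval (p : Polynomial (Polynomial ℂ)) :
    Continuous fun z : ℂ × ℂ => p.evalEval z.1 z.2 := by
  simp only [Polynomial.evalEval, Polynomial.eval_eq_sum_range (p := p), Polynomial.eval_finsetSum,
    Polynomial.eval_mul, Polynomial.eval_pow, Polynomial.eval_C]
  fun_prop

theorem Polynomial.continuous_eval₂_evalEval (Q : Polynomial (Polynomial (Polynomial ℂ))) (x : ℂ) :
    Continuous fun z : ℂ × ℂ => Q.eval₂ (Polynomial.evalEvalRingHom x z.2) z.1 := by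
  simp only [Polynomial.eval₂_eq_sum_range, Polynomial.coe_evalEvalRingHom]
  refine continuous_finsetSum _ fun i _ => ?_
  exact ((Polynomial.continuous_evalEval (Q.coeff i)).comp
    (continuous_const.prodMk continuous_snd)).mul (continuous_fst.pow i)

/-! ### ### Superlevel sets of algebraic fields near a limit line -/

/-- The positive finite values `σ` of `h` satisfy a polynomial equation in `x`, `w y` and
`σ ^ 2`. -/
structure IsAlgebraicField (h : ℝ → ℝ → EReal) (w w' : ℝ → ℂ)
    (P : Polynomial (Polynomial (Polynomial ℂ))) : Prop where
  continuous_uncurry : Continuous (Function.uncurry h)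
  hasDerivAt : ∀ y, HasDerivAt w (w' y) y
  continuous_deriv : Continuous w'
  deriv_ne_zero : ∀ y, w' y ≠ 0
  eval_eq_zero : ∀ x y σ : ℝ, 0 < σ → h x y = σ →
    P.eval₂ (Polynomial.evalEvalRingHom (x : ℂ) ((σ ^ 2 : ℝ) : ℂ)) (w y) = 0

namespace IsAlgebraicField

variable {h : ℝ → ℝ → EReal} {w w' : ℝ → ℂ} {P : Polynomial (Polynomial (Polynomial ℂ))}

theorem continuous_left (hL : IsAlgebraicField h w w' P) (y : ℝ) : Continuous fun x => h x y :=
  hL.continuous_uncurry.comp (continuous_id.prodMk continuous_const)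

theorem continuous_right (hL : IsAlgebraicField h w w' P) (x : ℝ) : Continuous (h x) :=
  hL.continuous_uncurry.comp (continuous_const.prodMk continuous_id)

/-- Here `e` plays the part of a discriminant: where it does not vanish, `(h x y) ^ 2` is given by
simple zeros in `w y`, and `not_isLocalMin_of_simple_zeros` applies. The one relation covers all `x`
at once. -/
theorem exists_ne_zero_of_isLocalMin (hL : IsAlgebraicField h w w' P) (hP : P ≠ 0) :
    ∃ e : Polynomial (Polynomial ℂ), e ≠ 0 ∧ ∀ x y σ : ℝ, 0 < σ → h x y = σ →
      IsLocalMin (h x) y → e.evalEval (x : ℂ) ((σ ^ 2 : ℝ) : ℂ) = 0 := by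
  obtain ⟨Q, e, he, H⟩ := Polynomial.exists_simple_zeros (F := ℂ) hP
  refine ⟨e, he, fun x y₀ σ hσ hσh hmin => ?_⟩
  by_contra hne
  have hwc : Continuous w :=
    continuous_iff_continuousAt.2 fun y => (hL.hasDerivAt y).continuousAt
  have hcont := hL.continuous_right x
  set u : ℝ → ℝ := fun y => (h x y).toReal ^ 2 with hu
  have huy₀ : u y₀ = σ ^ 2 := by simp [hu, hσh]
  have hfin : ∀ᶠ y in 𝓝 y₀, ∃ τ : ℝ, 0 < τ ∧ h x y = τ := by
    have h1 : ∀ᶠ y in 𝓝 y₀, 0 < h x y :=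
      hcont.continuousAt.eventually (lt_mem_nhds (by rw [hσh]; exact_mod_cast hσ))
    have h2 : ∀ᶠ y in 𝓝 y₀, h x y < ⊤ :=
      hcont.continuousAt.eventually (gt_mem_nhds (by rw [hσh]; exact EReal.coe_lt_top _))
    filter_upwards [h1, h2] with y hy1 hy2
    have e1 : ((h x y).toReal : EReal) = h x y :=
      EReal.coe_toReal hy2.ne (ne_of_gt (lt_trans (EReal.bot_lt_zero) hy1))
    exact ⟨(h x y).toReal, by rw [← e1] at hy1; exact_mod_cast hy1, e1.symm⟩
  have hucont : ∀ᶠ y in 𝓝 y₀, ContinuousAt u y := by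
    filter_upwards [hfin] with y ⟨τ, hτ, hy⟩
    refine ContinuousAt.pow ?_ 2
    refine (EReal.tendsto_toReal ?_ ?_).comp hcont.continuousAt <;> simp [hy]
  have hdz := (H (Polynomial.evalEvalRingHom (x : ℂ) ((σ ^ 2 : ℝ) : ℂ)) (w y₀)
    (by rwa [Polynomial.coe_evalEvalRingHom]))
  refine not_isLocalMin_of_simple_zeros
    (Φ := fun y s => Q.eval₂ (Polynomial.evalEvalRingHom (x : ℂ) (s : ℂ)) (w y))
    (Φ' := fun y s =>
      Q.derivative.eval₂ (Polynomial.evalEvalRingHom (x : ℂ) (s : ℂ)) (w y) * w' y)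
    (u := u) (y₀ := y₀) ?_ ?_ ?_ hucont ?_ ?_
  · refine ((Polynomial.continuous_eval₂_evalEval Q.derivative x).comp
      (g := fun z : ℂ × ℂ => _) (f := fun z : ℝ × ℝ => (w z.1, (z.2 : ℂ))) ?_).mul
      (hL.continuous_deriv.comp continuous_fst)
    exact (hwc.comp continuous_fst).prodMk (Complex.continuous_ofReal.comp continuous_snd)
  · intro y s
    have := ((Q.map (Polynomial.evalEvalRingHom (x : ℂ) (s : ℂ))).hasDerivAt (w y)).comp y
      (hL.hasDerivAt y)
    simpa only [Polynomial.derivative_map, Polynomial.eval_map, Function.comp_def] using this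
  · refine mul_ne_zero ?_ (hL.deriv_ne_zero y₀)
    rw [huy₀]
    exact hdz.2 (hdz.1 (hL.eval_eq_zero x y₀ σ hσ hσh))
  · have hene : ∀ᶠ y in 𝓝 y₀, e.evalEval (x : ℂ) (u y : ℂ) ≠ 0 := by
      have h1 : ContinuousAt (fun y => e.evalEval (x : ℂ) (u y : ℂ)) y₀ :=
        ((Polynomial.continuous_evalEval e).comp (continuous_const.prodMk
          Complex.continuous_ofReal) : Continuous fun s : ℝ =>
            e.evalEval (x : ℂ) (s : ℂ)).continuousAt.comp hucont.self_of_nhds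
      exact h1.eventually_ne (by rw [huy₀]; exact hne)
    filter_upwards [hfin, hene] with y ⟨τ, hτ, hy⟩ hey
    have huy : u y = τ ^ 2 := by simp [hu, hy]
    refine (H (Polynomial.evalEvalRingHom (x : ℂ) (u y : ℂ)) (w y) (by simpa using hey)).1 ?_
    rw [huy]
    exact hL.eval_eq_zero x y τ hτ hy
  · filter_upwards [hmin, hfin] with y hy ⟨τ, hτ, hyτ⟩
    rw [huy₀]
    simp only [hu, hyτ, EReal.toReal_coe]
    rw [hσh, hyτ] at hy
    exact pow_le_pow_left₀ hσ.le (by exact_mod_cast hy) 2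

end IsAlgebraicField

theorem Polynomial.eventually_nhdsLT_eval_ofReal_ne_zero {d : Polynomial ℂ} (hd : d ≠ 0) (x₀ : ℝ) :
    ∀ᶠ x : ℝ in 𝓝[<] x₀, d.eval (x : ℂ) ≠ 0 := by
  have hfin : {x : ℝ | d.eval (x : ℂ) = 0}.Finite := by
    refine ((Polynomial.finite_setOfPred_isRoot hd).preimage
      (Complex.ofReal_injective.injOn)).subset fun x hx => ?_
    exact hx
  have h1 : ∀ᶠ x : ℝ in 𝓝[≠] x₀, x ∉ {x : ℝ | d.eval (x : ℂ) = 0} \ {x₀} :=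
    nhdsWithin_le_nhds ((hfin.subset Set.sdiff_subset).isClosed.isOpen_compl.mem_nhds (by simp))
  have h2 := nhdsWithin_mono x₀ (fun x (hx : x < x₀) => hx.ne) h1
  filter_upwards [h2, self_mem_nhdsWithin] with x hx hx0 h
  exact hx ⟨h, ne_of_lt hx0⟩

namespace IsAlgebraicField

variable {h : ℝ → ℝ → EReal} {w w' : ℝ → ℂ} {P : Polynomial (Polynomial (Polynomial ℂ))}

/-- To the left of and close to `η`, the sublevel set of `h` cannot begin inside a box. -/
theorem exists_lt_of_boundary_lt (hL : IsAlgebraicField h w w' P) (hP : P ≠ 0) {γ : ℝ}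
    (hγ : 0 < γ) (η : ℝ) :
    ∃ δ > 0, ∀ x₁ t y₁ y₂ : ℝ, η - δ < x₁ → x₁ ≤ t → t < η →
      (∀ x ∈ Set.Icc x₁ t, (γ : EReal) < h x y₁ ∧ (γ : EReal) < h x y₂) →
      (∀ y ∈ Set.Icc y₁ y₂, (γ : EReal) < h x₁ y) → ∀ y ∈ Set.Icc y₁ y₂, (γ : EReal) < h t y := by
  obtain ⟨e, he, hcrit⟩ := hL.exists_ne_zero_of_isLocalMin hP
  -- The factor `s - γ²` must be split off, as `e` may vanish identically on the level `γ` itself.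
  -- The cofactor restricted to `s = γ²` is a nonzero polynomial in `x`, so it has no zeros just
  -- left of `η`.
  obtain ⟨D, hD, hDdvd⟩ := Polynomial.exists_eq_pow_rootMultiplicity_mul_and_not_dvd e he
    (Polynomial.C ((γ ^ 2 : ℝ) : ℂ))
  rw [Polynomial.dvd_iff_isRoot] at hDdvd
  have hev := Polynomial.eventually_nhdsLT_eval_ofReal_ne_zero hDdvd η
  obtain ⟨l, hl, hIoo⟩ := mem_nhdsLT_iff_exists_Ioo_subset.1 hev
  refine ⟨η - l, sub_pos.2 hl, fun x₁ t y₁ y₂ hx₁ hx₁t ht hside hleft => ?_⟩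
  by_contra! hbad
  obtain ⟨yb, hyb, hyb'⟩ := hbad
  have hcl : IsClosed {z : ℝ × ℝ | h z.1 z.2 ≤ (γ : EReal)} :=
    isClosed_Iic.preimage hL.continuous_uncurry
  -- The abscissas at which the box meets the sublevel set; the smallest one, `x₀`, is where that
  -- set begins.
  set B : Set ℝ := Prod.fst '' ((Set.Icc x₁ t ×ˢ Set.Icc y₁ y₂) ∩
    {z : ℝ × ℝ | h z.1 z.2 ≤ (γ : EReal)}) with hB
  have hBc : IsCompact B :=
    (((isCompact_Icc.prod isCompact_Icc).inter_right hcl).image continuous_fst)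
  have hBne : B.Nonempty := ⟨t, ⟨(t, yb), ⟨⟨⟨hx₁t, le_rfl⟩, hyb⟩, hyb'⟩, rfl⟩⟩
  have hx₀B := hBc.sInf_mem hBne
  set x₀ := sInf B with hx₀
  obtain ⟨⟨x₀', y₀⟩, ⟨⟨hx₀I, hy₀I⟩, hx₀y₀⟩, hfst⟩ := hx₀B
  simp only at hfst hx₀I hy₀I
  subst hfst
  simp only [Set.mem_ofPred_eq] at hx₀y₀
  have hgood : ∀ x, x₁ ≤ x → x < x₀ → ∀ y ∈ Set.Icc y₁ y₂, (γ : EReal) < h x y := by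
    intro x hx hxx₀ y hy
    by_contra hle
    have : x ∈ B := ⟨(x, y), ⟨⟨⟨hx, hxx₀.le.trans hx₀I.2⟩, hy⟩, not_lt.1 hle⟩, rfl⟩
    exact (csInf_le hBc.bddBelow this).not_gt hxx₀
  have hx₁x₀ : x₁ < x₀ := by
    refine lt_of_le_of_ne hx₀I.1 fun hEq => ?_
    have := hleft y₀ hy₀I
    rw [hEq] at this
    exact this.not_ge hx₀y₀
  have hD₀ : D.evalEval (x₀ : ℂ) ((γ ^ 2 : ℝ) : ℂ) ≠ 0 :=
    hIoo ⟨by linarith, hx₀I.2.trans_lt ht⟩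
  have hDev : ∀ᶠ z : ℝ × ℝ in 𝓝 (x₀, γ), D.evalEval (z.1 : ℂ) ((z.2 ^ 2 : ℝ) : ℂ) ≠ 0 := by
    have hc : Continuous fun z : ℝ × ℝ => D.evalEval (z.1 : ℂ) ((z.2 ^ 2 : ℝ) : ℂ) :=
      (Polynomial.continuous_evalEval D).comp (g := fun z : ℂ × ℂ => D.evalEval z.1 z.2)
        (f := fun z : ℝ × ℝ => ((z.1 : ℂ), ((z.2 ^ 2 : ℝ) : ℂ))) (by fun_prop)
    exact hc.continuousAt.eventually_ne hD₀
  rw [nhds_prod_eq] at hDev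
  obtain ⟨p₁, hp₁, p₂, hp₂, hp⟩ := eventually_prod_iff.1 hDev
  obtain ⟨τ, hτ, hball⟩ := Metric.eventually_nhds_iff_ball.1 hp₂
  -- For `x` slightly below `x₀`, the value at `y₀` is below `γ + τ` and below both side values. The
  -- minimum over `[y₁, y₂]` is then interior, with value strictly between `γ` and `γ + τ`.
  have ht0 : Tendsto (fun x => h x y₀) (𝓝 x₀) (𝓝 (h x₀ y₀)) := (hL.continuous_left y₀).tendsto x₀
  have ev1 : ∀ᶠ x in 𝓝 x₀, h x y₀ < ((γ + τ : ℝ) : EReal) :=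
    ht0.eventually (gt_mem_nhds (hx₀y₀.trans_lt (by exact_mod_cast (by linarith : γ < γ + τ))))
  have ev2 : ∀ᶠ x in 𝓝 x₀, h x y₀ < h x y₁ :=
    ht0.eventually_lt ((hL.continuous_left y₁).tendsto x₀) (hx₀y₀.trans_lt (hside x₀ hx₀I).1)
  have ev3 : ∀ᶠ x in 𝓝 x₀, h x y₀ < h x y₂ :=
    ht0.eventually_lt ((hL.continuous_left y₂).tendsto x₀) (hx₀y₀.trans_lt (hside x₀ hx₀I).2)
  have ev4 : ∀ᶠ x in 𝓝 x₀, x₁ < x := lt_mem_nhds hx₁x₀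
  have evall := nhdsWithin_le_nhds (s := Set.Iio x₀)
    (hp₁.and (ev1.and (ev2.and (ev3.and ev4))))
  obtain ⟨x, ⟨hpx, e1, e2, e3, e4⟩, hxx₀⟩ :=
    (Filter.Eventually.and evall self_mem_nhdsWithin).exists
  obtain ⟨y, hyI, hymin⟩ := (isCompact_Icc (a := y₁) (b := y₂)).exists_isMinOn ⟨y₀, hy₀I⟩
    (hL.continuous_right x).continuousOn
  have hyy₀ : h x y ≤ h x y₀ := hymin hy₀I
  have hgt : (γ : EReal) < h x y := hgood x e4.le hxx₀ y hyI
  have hyne : y ≠ y₁ ∧ y ≠ y₂ := by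
    constructor <;> rintro rfl
    · exact e2.not_ge hyy₀
    · exact e3.not_ge hyy₀
  have hyIoo : Set.Icc y₁ y₂ ∈ 𝓝 y :=
    Icc_mem_nhds (lt_of_le_of_ne hyI.1 hyne.1.symm) (lt_of_le_of_ne hyI.2 hyne.2)
  have hlt := hyy₀.trans_lt e1
  have hσ : ((h x y).toReal : EReal) = h x y :=
    EReal.coe_toReal (hlt.trans (EReal.coe_lt_top _)).ne ((EReal.bot_lt_coe γ).trans hgt).ne'
  set σ := (h x y).toReal with hσdef
  rw [← hσ] at hgt hlt
  have hγσ : γ < σ := by exact_mod_cast hgt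
  have hστ : σ < γ + τ := by exact_mod_cast hlt
  have hzero := hcrit x y σ (hγ.trans hγσ) hσ.symm (hymin.isLocalMin hyIoo)
  have hDx : D.evalEval (x : ℂ) ((σ ^ 2 : ℝ) : ℂ) ≠ 0 := by
    refine hp hpx (hball σ ?_)
    rw [Metric.mem_ball, Real.dist_eq, abs_lt]
    constructor <;> linarith
  rw [hD] at hzero
  simp only [Polynomial.evalEval_mul, Polynomial.evalEval_pow, Polynomial.evalEval_sub,
    Polynomial.evalEval_X, Polynomial.evalEval_C, Polynomial.eval_C] at hzero
  have hne : ((σ ^ 2 : ℝ) : ℂ) - ((γ ^ 2 : ℝ) : ℂ) ≠ 0 := by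
    rw [← Complex.ofReal_sub, Complex.ofReal_ne_zero]
    nlinarith
  exact (mul_ne_zero (pow_ne_zero _ hne) hDx) hzero

/-- For a dense set of `y`, the function `h · y` avoids the value `γ` just to the left of `η`. -/
theorem exists_generic (hL : IsAlgebraicField h w w' P) {γ : ℝ} (hγ : 0 < γ) {x₀ : ℝ} {w₀ : ℂ}
    (h₀ : P.eval₂ (Polynomial.evalEvalRingHom (x₀ : ℂ) ((γ ^ 2 : ℝ) : ℂ)) w₀ ≠ 0) (η : ℝ)
    {a b : ℝ} (hab : a < b) :
    ∃ y ∈ Set.Ioo a b, ∀ᶠ x in 𝓝[<] η, h x y ≠ γ := by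
  set f := P.map (Polynomial.evalEvalRingHom (x₀ : ℂ) ((γ ^ 2 : ℝ) : ℂ)) with hf
  have hf0 : f ≠ 0 := by
    intro h0
    rw [← Polynomial.eval_map, ← hf, h0] at h₀
    simp at h₀
  have hmid : (a + b) / 2 ∈ Set.Ioo a b := ⟨by linarith, by linarith⟩
  -- Since `w` has nonzero derivative, it avoids the finitely many roots of `f` at points close to
  -- the midpoint. For such a `y` the polynomial `d` in `x` is nonzero at `x₀`, so its zeros are
  -- finite in number.
  have hev : ∀ᶠ y in 𝓝[≠] ((a + b) / 2), ∀ z ∈ {z | f.IsRoot z}, w y ≠ z :=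
    (Filter.eventually_all_finite (Polynomial.finite_setOfPred_isRoot hf0)).2 fun z _ =>
      (hL.hasDerivAt _).eventually_ne (hL.deriv_ne_zero _)
  obtain ⟨y, hy, hyI⟩ := (hev.and (nhdsWithin_le_nhds (Ioo_mem_nhds hmid.1 hmid.2))).exists
  refine ⟨y, hyI, ?_⟩
  set d : Polynomial ℂ :=
    (P.eval (Polynomial.C (Polynomial.C (w y)))).eval (Polynomial.C ((γ ^ 2 : ℝ) : ℂ)) with hd
  have hdx : ∀ x : ℂ, d.eval x =
      P.eval₂ (Polynomial.evalEvalRingHom x ((γ ^ 2 : ℝ) : ℂ)) (w y) := by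
    intro x
    have := Polynomial.eval₂_at_apply (p := P)
      (Polynomial.evalEvalRingHom x ((γ ^ 2 : ℝ) : ℂ)) (Polynomial.C (Polynomial.C (w y)))
    simpa [hd, Polynomial.evalEval] using this.symm
  have hd0 : d ≠ 0 := by
    intro h0
    refine hy (w y) ?_ rfl
    rw [Set.mem_ofPred_eq, Polynomial.IsRoot.def, hf, Polynomial.eval_map, ← hdx, h0,
      Polynomial.eval_zero]
  filter_upwards [Polynomial.eventually_nhdsLT_eval_ofReal_ne_zero hd0 η] with x hx hxy
  exact hx ((hdx x).trans (hL.eval_eq_zero x y γ hγ hxy))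

/-- Estimates `η k` increasing to a limit cannot have superlevel intervals of length bounded below
whose midpoints are blocked before the limit. -/
theorem not_frequently_blocked (hL : IsAlgebraicField h w w' P) {γ : ℝ} (hγ : 0 < γ) {x₀ : ℝ}
    {w₀ : ℂ} (h₀ : P.eval₂ (Polynomial.evalEvalRingHom (x₀ : ℂ) ((γ ^ 2 : ℝ) : ℂ)) w₀ ≠ 0)
    {η : ℕ → ℝ} {η' : ℝ} (hη : Tendsto η atTop (𝓝 η')) (hlt : ∀ k, η k < η') {K δ : ℝ}
    (hδ : 0 < δ) :
    ¬ ∃ᶠ k in atTop, ∃ c d, c ∈ Set.Icc (-K) K ∧ d ∈ Set.Icc (-K) K ∧ δ ≤ d - c ∧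
      (∀ y ∈ Set.Ioo c d, (γ : EReal) < h (η k) y) ∧
        ∃ t, η k ≤ t ∧ t < η' ∧ h t ((c + d) / 2) ≤ γ := by
  intro hfreq
  have hP : P ≠ 0 := fun h => h₀ (by simp [h])
  obtain ⟨φ, hφ, H⟩ := extraction_of_frequently_atTop hfreq
  choose c d hc hd hcd hab t ht1 ht2 ht3 using H
  -- Along a subsequence the intervals converge to one of length at least `δ`, so fixed side
  -- positions can be chosen around its midpoint.
  obtain ⟨⟨c₀, d₀⟩, -, ψ, hψ, hlim⟩ := (isCompact_Icc.prod isCompact_Icc).tendsto_subseq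
    (x := fun n => (c n, d n)) (fun n => Set.mk_mem_prod (hc n) (hd n))
  have hclim : Tendsto (fun n => c (ψ n)) atTop (𝓝 c₀) := (continuous_fst.tendsto _).comp hlim
  have hdlim : Tendsto (fun n => d (ψ n)) atTop (𝓝 d₀) := (continuous_snd.tendsto _).comp hlim
  have hηlim : Tendsto (fun n => η (φ (ψ n))) atTop (𝓝 η') :=
    hη.comp (hφ.comp hψ).tendsto_atTop
  have hcd₀ : δ ≤ d₀ - c₀ := ge_of_tendsto' (hdlim.sub hclim) fun n => hcd _
  set m := (c₀ + d₀) / 2 with hm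
  have hmlim : Tendsto (fun n => (c (ψ n) + d (ψ n)) / 2) atTop (𝓝 m) :=
    (hclim.add hdlim).div_const 2
  obtain ⟨y₁, hy₁, hev₁⟩ := hL.exists_generic hγ h₀ η' (show c₀ < m by linarith)
  obtain ⟨y₂, hy₂, hev₂⟩ := hL.exists_generic hγ h₀ η' (show m < d₀ by linarith)
  obtain ⟨δ', hδ', htrap⟩ := hL.exists_lt_of_boundary_lt hP hγ η'
  obtain ⟨l, hl, hIoo⟩ := mem_nhdsLT_iff_exists_Ioo_subset.1 (hev₁.and hev₂)
  have evs := (hηlim.eventually (lt_mem_nhds (show max l (η' - δ') < η' from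
      max_lt hl (by linarith)))).and
    ((hclim.eventually (gt_mem_nhds hy₁.1)).and ((hdlim.eventually (lt_mem_nhds hy₂.2)).and
      ((hmlim.eventually (lt_mem_nhds hy₁.2)).and (hmlim.eventually (gt_mem_nhds hy₂.1)))))
  obtain ⟨n, hn1, hn2, hn3, hn4, hn5⟩ := evs.exists
  have hη1 := (le_max_left _ _).trans_lt hn1
  have hη2 := (le_max_right _ _).trans_lt hn1
  have hy12 : y₁ < y₂ := hy₁.2.trans hy₂.1
  have hbox : ∀ y ∈ Set.Icc y₁ y₂, (γ : EReal) < h (η (φ (ψ n))) y := fun y hy =>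
    hab (ψ n) y ⟨hn2.trans_le hy.1, hy.2.trans_lt hn3⟩
  refine (ht3 (ψ n)).not_gt (htrap _ _ y₁ y₂ hη2 (ht1 _) (ht2 _) (fun x hx => ?_) hbox _
    ⟨hn4.le, hn5.le⟩)
  have hx' : x ∈ Set.Ioo l η' := ⟨hη1.trans_le hx.1, hx.2.trans_lt (ht2 _)⟩
  have hηI : η (φ (ψ n)) ∈ Set.Ioo l η' := ⟨hη1, hlt _⟩
  constructor
  · exact lt_on_of_ne isPreconnected_Ioo (hL.continuous_left y₁).continuousOn
      (fun x hx => (hIoo hx).1) hηI (hbox y₁ ⟨le_rfl, hy12.le⟩) x hx'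
  · exact lt_on_of_ne isPreconnected_Ioo (hL.continuous_left y₂).continuousOn
      (fun x hx => (hIoo hx).2) hηI (hbox y₂ ⟨hy12.le, le_rfl⟩) x hx'

end IsAlgebraicField

/-! ### Singular values and determinants -/

theorem Matrix.isUnit_iff_det_ne_zero {ι : Type*} [Fintype ι] [DecidableEq ι] (M : Matrix ι ι ℂ) :
    IsUnit M ↔ M.det ≠ 0 := by
  rw [Matrix.isUnit_iff_isUnit_det, isUnit_iff_ne_zero]

open scoped MatrixOrder ComplexOrder in
/-- The square of a positive spectral norm is an eigenvalue of `Mᴴ * M`. -/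
theorem Matrix.det_norm_sq_sub_conjTranspose_mul_self {k l : ℕ} (M : Matrix (Fin k) (Fin l) ℂ)
    (hM : 0 < ‖M‖) : (((‖M‖ ^ 2 : ℝ) : ℂ) • 1 - Mᴴ * M).det = 0 := by
  have hnt : Nontrivial (Matrix (Fin l) (Fin l) ℂ) := by
    by_contra h
    rw [not_nontrivial_iff_subsingleton] at h
    have := Matrix.l2_opNorm_conjTranspose_mul_self M
    rw [Subsingleton.elim (Mᴴ * M) 0, norm_zero] at this
    nlinarith
  have hmem := CStarAlgebra.norm_mem_spectrum_of_nonneg (a := Mᴴ * M)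
    (Matrix.posSemidef_conjTranspose_mul_self M).nonneg
  rw [Matrix.l2_opNorm_conjTranspose_mul_self, spectrum.mem_iff, Matrix.isUnit_iff_det_ne_zero,
    not_not, Algebra.algebraMap_eq_smul_one] at hmem
  convert hmem using 3
  rw [Complex.coe_smul, sq]

theorem Matrix.det_sq_sub_conjTranspose_mul_self_ne_zero {k l : ℕ} (M : Matrix (Fin k) (Fin l) ℂ)
    {γ : ℝ} (hM : ‖M‖ < γ) : (((γ ^ 2 : ℝ) : ℂ) • 1 - Mᴴ * M).det ≠ 0 := by
  rcases isEmpty_or_nonempty (Fin l) with h | h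
  · simp
  have hγ : 0 < γ := (norm_nonneg M).trans_lt hM
  rw [← Matrix.isUnit_iff_det_ne_zero, ← Algebra.algebraMap_eq_smul_one]
  by_contra hmem
  have h1 := spectrum.norm_le_norm_of_mem (spectrum.mem_iff.2 hmem)
  rw [Matrix.l2_opNorm_conjTranspose_mul_self, Complex.norm_real, Real.norm_of_nonneg (by positivity)] at h1
  nlinarith [norm_nonneg M]

namespace LTISystem

variable {n m p : ℕ} (S : LTISystem n m p)

/-! ### The eigenvalues of the pencil and the transfer function -/

theorem notMem_eig_iff {z : ℂ} : z ∉ S.eig ↔ IsUnit (z • S.E - S.A) := by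
  rw [Matrix.isUnit_iff_det_ne_zero]; rfl

theorem eig_eq_spectrum (hE : IsUnit S.E) : S.eig = spectrum ℂ (S.E⁻¹ * S.A) := by
  ext z
  rw [← not_iff_not, notMem_eig_iff, spectrum.notMem_iff, Algebra.algebraMap_eq_smul_one]
  have h : z • S.E - S.A = S.E * (z • 1 - S.E⁻¹ * S.A) := by
    rw [mul_sub, ← mul_assoc, Matrix.mul_nonsing_inv _ ((Matrix.isUnit_iff_isUnit_det _).1 hE),
      one_mul, Matrix.mul_smul, mul_one]
  rw [h]
  obtain ⟨u, hu⟩ := hE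
  rw [← hu]
  exact Units.isUnit_units_mul u _

theorem finite_eig (hE : IsUnit S.E) : S.eig.Finite := by
  rw [S.eig_eq_spectrum hE]
  exact Matrix.finite_spectrum _

theorem nonempty_eig (hn : 0 < n) (hE : IsUnit S.E) : S.eig.Nonempty := by
  have : Nonempty (Fin n) := ⟨⟨0, hn⟩⟩
  rw [S.eig_eq_spectrum hE]
  exact spectrum.nonempty_of_isAlgClosed_of_finiteDimensional ℂ _

theorem eventually_notMem_eig (hE : IsUnit S.E) (z : ℂ) : ∀ᶠ w in 𝓝[≠] z, w ∉ S.eig := by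
  have h1 : ∀ᶠ w in 𝓝[≠] z, w ∉ S.eig \ {z} := nhdsWithin_le_nhds
    (((S.finite_eig hE).subset Set.sdiff_subset).isClosed.isOpen_compl.mem_nhds (by simp))
  filter_upwards [h1, self_mem_nhdsWithin] with w hw hwz h
  exact hw ⟨h, hwz⟩

theorem continuousAt_transfer {z : ℂ} (hz : z ∉ S.eig) : ContinuousAt S.transfer z := by
  have hX : Continuous fun w : ℂ => w • S.E - S.A := by fun_prop
  have hdet : (z • S.E - S.A).det ≠ 0 := hz
  have hinv : ContinuousAt (fun w : ℂ => (w • S.E - S.A)⁻¹) z := by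
    simp only [Matrix.inv_def, Ring.inverse_eq_inv']
    exact (hX.matrix_det.continuousAt.inv₀ hdet).smul hX.matrix_adjugate.continuousAt
  have h2 : Continuous fun Y : Matrix (Fin n) (Fin n) ℂ => S.C * Y * S.B + S.D :=
    (((continuous_const (y := S.C)).matrix_mul continuous_id).matrix_mul
      (continuous_const (y := S.B))).add continuous_const
  exact h2.continuousAt.comp (f := fun w : ℂ => (w • S.E - S.A)⁻¹) hinv

/-- By the adjugate formula the entries are rational in `z`. -/
theorem meromorphicAt_transfer (z : ℂ) : MeromorphicAt S.transfer z := by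
  have hdet : ∀ N : ℂ → Matrix (Fin n) (Fin n) ℂ, (∀ i j, MeromorphicAt (fun w => N w i j) z) →
      MeromorphicAt (fun w => (N w).det) z := by
    intro N hN
    simp only [Matrix.det_apply']
    exact MeromorphicAt.fun_sum fun σ _ => (MeromorphicAt.const _ z).mul
      (MeromorphicAt.fun_prod fun i _ => hN (σ i) i)
  have hX : ∀ i j, MeromorphicAt (fun w : ℂ => (w • S.E - S.A) i j) z := fun i j =>
    ((MeromorphicAt.id z).mul (.const (S.E i j) z)).sub (.const (S.A i j) z)
  have hinv : ∀ i j, MeromorphicAt (fun w : ℂ => (w • S.E - S.A)⁻¹ i j) z := by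
    intro i j
    simp only [Matrix.inv_def, Ring.inverse_eq_inv', Matrix.smul_apply, smul_eq_mul,
      Matrix.adjugate_apply]
    refine (hdet _ hX).inv.mul (hdet _ fun k l => ?_)
    by_cases hk : k = j
    · subst hk
      simpa only [Matrix.updateRow_self] using .const _ z
    · simpa only [Matrix.updateRow_ne hk] using hX k l
  have hentry : ∀ i j, MeromorphicAt (fun w : ℂ => S.transfer w i j) z := by
    intro i j
    simp only [transfer, Matrix.add_apply, Matrix.mul_apply]
    exact (MeromorphicAt.fun_sum fun k _ => (MeromorphicAt.fun_sum fun l _ =>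
      (MeromorphicAt.const _ z).mul (hinv l k)).mul (.const _ z)).add (.const _ z)
  have hsum : S.transfer = fun w => ∑ i, ∑ j, S.transfer w i j • Matrix.single i j (1 : ℂ) := by
    funext w
    simpa [Matrix.smul_single] using Matrix.matrix_eq_sum_single (S.transfer w)
  rw [hsum]
  exact MeromorphicAt.fun_sum fun i _ => MeromorphicAt.fun_sum fun j _ =>
    (hentry i j).smul (.const _ z)

/-! ### The extended norm of the transfer function -/

theorem ntf_of_notMem {z : ℂ} (hz : z ∉ S.eig) : S.ntf z = ((‖S.transfer z‖ : ℝ) : EReal) := by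
  rw [ntf, if_neg hz]

/-- The sign of the meromorphic order decides between a pole and a removable singularity. In
particular the `limsup` defining `ntf` is a limit. -/
theorem tendsto_transfer (z : ℂ) :
    (S.ntf z = ⊤ ∧ Tendsto (fun w => ((‖S.transfer w‖ : ℝ) : EReal)) (𝓝[≠] z) (𝓝 ⊤)) ∨
      ∃ G, Tendsto S.transfer (𝓝[≠] z) (𝓝 G) ∧ S.ntf z = ((‖G‖ : ℝ) : EReal) := by
  by_cases hz : z ∈ S.eig
  · rcases lt_or_ge (meromorphicOrderAt S.transfer z) 0 with h | h
    · left
      have h1 := tendsto_norm_cobounded_atTop.comp (tendsto_cobounded_of_meromorphicOrderAt_neg h)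
      have h2 : Tendsto (fun w => ((‖S.transfer w‖ : ℝ) : EReal)) (𝓝[≠] z) (𝓝 ⊤) :=
        EReal.tendsto_coe_atTop.comp h1
      exact ⟨by rw [ntf, if_pos hz]; exact h2.limsup_eq, h2⟩
    · right
      obtain ⟨G, hG⟩ := tendsto_nhds_of_meromorphicOrderAt_nonneg (S.meromorphicAt_transfer z) h
      refine ⟨G, hG, ?_⟩
      have h2 : Tendsto (fun w => ((‖S.transfer w‖ : ℝ) : EReal)) (𝓝[≠] z) (𝓝 ((‖G‖ : ℝ) : EReal)) :=
        (continuous_coe_real_ereal.tendsto _).comp hG.norm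
      rw [ntf, if_pos hz]; exact h2.limsup_eq
  · exact Or.inr ⟨S.transfer z, (S.continuousAt_transfer hz).tendsto.mono_left nhdsWithin_le_nhds,
      S.ntf_of_notMem hz⟩

theorem continuous_ntf (hE : IsUnit S.E) : Continuous S.ntf := by
  refine continuous_iff_continuousAt.2 fun z => continuousAt_of_tendsto_nhds (y := S.ntf z) ?_
  rw [← nhdsNE_sup_pure, tendsto_sup]
  refine ⟨?_, tendsto_pure_nhds _ _⟩
  have heq : (fun w => ((‖S.transfer w‖ : ℝ) : EReal)) =ᶠ[𝓝[≠] z] S.ntf := by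
    filter_upwards [S.eventually_notMem_eig hE z] with w hw using (S.ntf_of_notMem hw).symm
  refine Tendsto.congr' heq ?_
  rcases S.tendsto_transfer z with ⟨h, h'⟩ | ⟨G, hG, h⟩
  · rwa [h]
  · rw [h]; exact (continuous_coe_real_ereal.tendsto _).comp hG.norm

/-- The transfer function with its removable singularities removed. -/
noncomputable def transferExt (z : ℂ) : Matrix (Fin p) (Fin m) ℂ := limUnder (𝓝[≠] z) S.transfer

theorem transferExt_of_notMem {z : ℂ} (hz : z ∉ S.eig) : S.transferExt z = S.transfer z :=
  ((S.continuousAt_transfer hz).tendsto.mono_left nhdsWithin_le_nhds).limUnder_eq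

theorem norm_transferExt {z : ℂ} (hz : S.ntf z ≠ ⊤) :
    S.ntf z = ((‖S.transferExt z‖ : ℝ) : EReal) := by
  rcases S.tendsto_transfer z with ⟨h, -⟩ | ⟨G, hG, h⟩
  · exact absurd h hz
  · rw [h, transferExt, hG.limUnder_eq]

/-- Riemann's theorem on removable singularities. The maximum principle needs this extension because
at eigenvalues `transfer` takes the default value of the matrix inverse. -/
theorem differentiableAt_transferExt (hE : IsUnit S.E) {z : ℂ} (hz : S.ntf z ≠ ⊤) :
    DifferentiableAt ℂ S.transferExt z := by
  have heq : ∀ w ∉ S.eig, S.transferExt =ᶠ[𝓝 w] S.transfer := by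
    intro w hw
    filter_upwards [(S.finite_eig hE).isClosed.isOpen_compl.mem_nhds hw] with v hv using
      S.transferExt_of_notMem hv
  refine (Complex.analyticAt_of_differentiable_on_punctured_nhds_of_continuousAt ?_ ?_
    ).differentiableAt
  · filter_upwards [S.eventually_notMem_eig hE z] with w hw
    exact (heq w hw).differentiableAt_iff.2 ((S.meromorphicAt_transfer w).analyticAt
      (S.continuousAt_transfer hw)).differentiableAt
  · rcases S.tendsto_transfer z with ⟨h, -⟩ | ⟨G, hG, -⟩
    · exact absurd h hz
    · refine continuousAt_of_tendsto_nhds (y := G) ?_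
      rw [← nhdsNE_sup_pure, tendsto_sup]
      refine ⟨hG.congr' ?_, ?_⟩
      · filter_upwards [S.eventually_notMem_eig hE z] with w hw using
          (S.transferExt_of_notMem hw).symm
      · rw [← hG.limUnder_eq]; exact tendsto_pure_nhds _ _

/-- The transfer function tends to `D` at infinity. -/
theorem exists_forall_ntf_lt (hE : IsUnit S.E) {γ : ℝ} (hD : ‖S.D‖ < γ) :
    ∃ M : ℝ, ∀ z : ℂ, M ≤ ‖z‖ → z ∉ S.eig ∧ S.ntf z < γ := by
  -- With `t = z⁻¹`, the resolvent `(zE - A)⁻¹` becomes `t (E - tA)⁻¹`, which is continuous at `t =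
  -- 0` and vanishes there.
  have hcont : ContinuousAt (fun t : ℂ => ‖S.C * (t • (S.E - t • S.A)⁻¹) * S.B + S.D‖) 0 := by
    have hX : Continuous fun t : ℂ => S.E - t • S.A := by fun_prop
    have hdet : (S.E - (0 : ℂ) • S.A).det ≠ 0 := by
      rw [zero_smul, sub_zero]; exact (Matrix.isUnit_iff_det_ne_zero _).1 hE
    have hinv : ContinuousAt (fun t : ℂ => t • (S.E - t • S.A)⁻¹) 0 := by
      refine continuousAt_id.smul ?_
      simp only [Matrix.inv_def, Ring.inverse_eq_inv']
      exact (hX.matrix_det.continuousAt.inv₀ hdet).smul hX.matrix_adjugate.continuousAt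
    have h2 : Continuous fun Y : Matrix (Fin n) (Fin n) ℂ => ‖S.C * Y * S.B + S.D‖ :=
      ((((continuous_const (y := S.C)).matrix_mul continuous_id).matrix_mul
        (continuous_const (y := S.B))).add continuous_const).norm
    exact h2.continuousAt.comp (f := fun t : ℂ => t • (S.E - t • S.A)⁻¹) hinv
  have hev : ∀ᶠ t in 𝓝 (0 : ℂ), ‖S.C * (t • (S.E - t • S.A)⁻¹) * S.B + S.D‖ < γ :=
    hcont.eventually (gt_mem_nhds (by simpa using hD))
  have hev2 : ∀ᶠ z in Bornology.cobounded ℂ, z ∉ S.eig ∧ S.ntf z < γ := by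
    filter_upwards [tendsto_inv₀_cobounded.eventually hev,
      Bornology.isBounded_def.1 (S.finite_eig hE).isBounded,
      Bornology.isBounded_def.1 (Bornology.isBounded_singleton (x := (0 : ℂ)))] with z hz hzE hz0
    refine ⟨hzE, ?_⟩
    rw [S.ntf_of_notMem hzE, EReal.coe_lt_coe_iff, transfer]
    convert hz using 5
    have : z • S.E - S.A = z • (S.E - z⁻¹ • S.A) := by
      rw [smul_sub, smul_smul, mul_inv_cancel₀ hz0, one_smul]
    have hu : IsUnit (S.E - z⁻¹ • S.A) := by
      rw [Matrix.isUnit_iff_det_ne_zero]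
      intro h0
      exact hzE (by rw [eig, pencilSpec, Set.mem_ofPred_eq, this, Matrix.det_smul, h0, mul_zero])
    rw [this]
    refine Matrix.inv_eq_left_inv ?_
    rw [Matrix.smul_mul, Matrix.mul_smul, smul_smul, inv_mul_cancel₀ hz0, one_smul,
      Matrix.nonsing_inv_mul _ ((Matrix.isUnit_iff_isUnit_det _).1 hu)]
  rw [← comap_norm_atTop] at hev2
  obtain ⟨M, hM⟩ := (eventually_atTop.1 (eventually_comap.1 hev2))
  exact ⟨M, fun z hz => hM ‖z‖ hz z rfl⟩

end LTISystem

/-! ### ### The singular value determinant and its two eliminations -/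

namespace LTISystem

variable {n m p : ℕ} (S : LTISystem n m p)

/-- The determinant of the homogenized singular value pencil of the transfer function, with
parameters in a commutative ring. -/
noncomputable def svDet {R : Type*} [CommRing R] (c : ℂ →+* R) (z u v s : R) : R :=
  (z • (Matrix.fromBlocks (Matrix.fromBlocks S.E 0 0 0) 0 0
      (0 : Matrix (Fin m) (Fin m) ℂ) : Matrix ((Fin n ⊕ Fin n) ⊕ Fin m) _ ℂ).map c +
    u • (Matrix.fromBlocks (Matrix.fromBlocks 0 0 (-(S.Cᴴ * S.C)) (-S.Aᴴ))
      (Matrix.fromRows 0 (-(S.Cᴴ * S.D))) 0 0).map c +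
    v • (Matrix.fromBlocks (Matrix.fromBlocks 0 0 0 S.Eᴴ) 0 0 0).map c +
    s • (Matrix.fromBlocks 0 0 0 1).map c +
    (Matrix.fromBlocks (Matrix.fromBlocks (-S.A) 0 0 0) (Matrix.fromRows (-S.B) 0)
      (Matrix.fromCols (-(S.Dᴴ * S.C)) (-S.Bᴴ)) (-(S.Dᴴ * S.D))).map c).det

theorem map_svDet {R T : Type*} [CommRing R] [CommRing T] (c : ℂ →+* R) (f : R →+* T)
    (z u v s : R) : f (S.svDet c z u v s) = S.svDet (f.comp c) (f z) (f u) (f v) (f s) := by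
  rw [svDet, svDet, RingHom.map_det]
  congr 1
  ext i j
  simp

/-- For `u = 1`, `v = z̄` and `z` off the eigenvalues, a kernel vector `(x, y, b)` satisfies `(zE -
A) x = B b`, `(zE - A)ᴴ y = Cᴴ (C x + D b)` and `s b = Dᴴ (C x + D b) + Bᴴ y`, that is, `Gᴴ G b = s
b`. The matrix contains no inverse, so it also makes sense at eigenvalues of the pencil. -/
theorem svDet_eq_det (z u v s : ℂ) : S.svDet (RingHom.id ℂ) z u v s =
    (Matrix.fromBlocks (Matrix.fromBlocks (z • S.E - S.A) 0 (-(u • (S.Cᴴ * S.C)))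
        (v • S.Eᴴ - u • S.Aᴴ)) (Matrix.fromRows (-S.B) (-(u • (S.Cᴴ * S.D))))
      (Matrix.fromCols (-(S.Dᴴ * S.C)) (-S.Bᴴ)) (s • 1 - S.Dᴴ * S.D)).det := by
  rw [svDet]
  congr 1
  ext i j
  rcases i with (i | i) | i <;> rcases j with (j | j) | j <;>
    simp [sub_eq_add_neg, Matrix.one_apply, add_comm]

/-- On a circle `z̄ = r / w` with `w = exp (i θ)` is not polynomial in `w`; taking `u = w` clears
this denominator at the cost of a factor `w ^ n`. -/
theorem svDet_smul (z u v s : ℂ) : S.svDet (RingHom.id ℂ) z u (u * v) s =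
    u ^ n * S.svDet (RingHom.id ℂ) z 1 v s := by
  rw [svDet_eq_det, svDet_eq_det]
  have h : Matrix.fromBlocks (Matrix.fromBlocks (z • S.E - S.A) 0 (-(u • (S.Cᴴ * S.C)))
        ((u * v) • S.Eᴴ - u • S.Aᴴ)) (Matrix.fromRows (-S.B) (-(u • (S.Cᴴ * S.D))))
      (Matrix.fromCols (-(S.Dᴴ * S.C)) (-S.Bᴴ)) (s • 1 - S.Dᴴ * S.D) =
      Matrix.fromBlocks (Matrix.fromBlocks (1 : Matrix (Fin n) (Fin n) ℂ) 0 0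
        (u • (1 : Matrix (Fin n) (Fin n) ℂ))) 0 0 (1 : Matrix (Fin m) (Fin m) ℂ) *
      Matrix.fromBlocks (Matrix.fromBlocks (z • S.E - S.A) 0 (-((1 : ℂ) • (S.Cᴴ * S.C)))
        (v • S.Eᴴ - (1 : ℂ) • S.Aᴴ)) (Matrix.fromRows (-S.B) (-((1 : ℂ) • (S.Cᴴ * S.D))))
      (Matrix.fromCols (-(S.Dᴴ * S.C)) (-S.Bᴴ)) (s • 1 - S.Dᴴ * S.D) := by
    rw [Matrix.fromBlocks_multiply, Matrix.fromBlocks_multiply, Matrix.fromBlocks_mul_fromRows]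
    simp [smul_sub, smul_smul]
  rw [h, Matrix.det_mul, Matrix.det_fromBlocks_zero₁₂, Matrix.det_fromBlocks_zero₁₂]
  simp

/-- Elimination of the state variables. -/
theorem svDet_eq_of_notMem {z : ℂ} (hz : z ∉ S.eig) (s : ℂ) :
    S.svDet (RingHom.id ℂ) z 1 (starRingEnd ℂ z) s = (z • S.E - S.A).det *
      (z • S.E - S.A)ᴴ.det * (s • 1 - (S.transfer z)ᴴ * S.transfer z).det := by
  have hu := (Matrix.isUnit_iff_isUnit_det _).1 (S.notMem_eig_iff.1 hz)
  set X := z • S.E - S.A with hX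
  have hXH : Xᴴ = starRingEnd ℂ z • S.Eᴴ - (1 : ℂ) • S.Aᴴ := by
    rw [hX, Matrix.conjTranspose_sub, Matrix.conjTranspose_smul, one_smul]; rfl
  have huH : IsUnit Xᴴ.det := by rw [Matrix.det_conjTranspose]; exact hu.star
  set G := S.transfer z with hG
  have hGdef : S.C * X⁻¹ * S.B + S.D = G := rfl
  have hGH : S.Bᴴ * (Xᴴ)⁻¹ * S.Cᴴ + S.Dᴴ = Gᴴ := by
    rw [← hGdef, Matrix.conjTranspose_add, Matrix.conjTranspose_mul, Matrix.conjTranspose_mul,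
      Matrix.conjTranspose_nonsing_inv, Matrix.mul_assoc]
  rw [svDet_eq_det, ← hX, ← hXH]
  -- The column operation that inserts the solved states; it clears the upper right block.
  set U : Matrix ((Fin n ⊕ Fin n) ⊕ Fin m) ((Fin n ⊕ Fin n) ⊕ Fin m) ℂ :=
    Matrix.fromBlocks 1 (Matrix.fromRows (X⁻¹ * S.B) ((Xᴴ)⁻¹ * S.Cᴴ * G)) 0 1 with hU
  have hdetU : U.det = 1 := by rw [hU, Matrix.det_fromBlocks_zero₂₁]; simp
  have e1 : X * (X⁻¹ * S.B) = S.B := by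
    rw [← Matrix.mul_assoc, Matrix.mul_nonsing_inv _ hu, Matrix.one_mul]
  have e2 : Xᴴ * ((Xᴴ)⁻¹ * S.Cᴴ * G) = S.Cᴴ * G := by
    rw [Matrix.mul_assoc, ← Matrix.mul_assoc, Matrix.mul_nonsing_inv _ huH, Matrix.one_mul]
  have e3 : S.Cᴴ * S.C * (X⁻¹ * S.B) + S.Cᴴ * S.D = S.Cᴴ * G := by
    rw [← hGdef, Matrix.mul_add]; simp only [Matrix.mul_assoc]
  have e4 : S.Dᴴ * S.C * (X⁻¹ * S.B) + S.Bᴴ * ((Xᴴ)⁻¹ * S.Cᴴ * G) + S.Dᴴ * S.D = Gᴴ * G := by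
    conv_rhs => rw [← hGH, Matrix.add_mul]
    conv_rhs => enter [2]; rw [← hGdef, Matrix.mul_add]
    simp only [Matrix.mul_assoc]
    abel
  have hprod : Matrix.fromBlocks (Matrix.fromBlocks X 0 (-((1 : ℂ) • (S.Cᴴ * S.C))) Xᴴ)
      (Matrix.fromRows (-S.B) (-((1 : ℂ) • (S.Cᴴ * S.D))))
      (Matrix.fromCols (-(S.Dᴴ * S.C)) (-S.Bᴴ)) (s • 1 - S.Dᴴ * S.D) * U =
      Matrix.fromBlocks (Matrix.fromBlocks X 0 (-((1 : ℂ) • (S.Cᴴ * S.C))) Xᴴ) 0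
      (Matrix.fromCols (-(S.Dᴴ * S.C)) (-S.Bᴴ)) (s • 1 - Gᴴ * G) := by
    rw [hU, Matrix.fromBlocks_multiply, Matrix.fromBlocks_mul_fromRows,
      Matrix.fromCols_mul_fromRows]
    congr 1
    · simp
    · ext i j
      rcases i with i | i
      · simp [e1]
      · have := congrFun (congrFun e3 i) j
        simp only [Matrix.add_apply] at this
        simp [e2, ← this]
    · simp
    · rw [← e4]; simp only [Matrix.neg_mul, Matrix.mul_one]; abel
  have hdet := congrArg Matrix.det hprod
  rwa [Matrix.det_mul, hdetU, mul_one, Matrix.det_fromBlocks_zero₁₂,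
    Matrix.det_fromBlocks_zero₁₂] at hdet

end LTISystem

/-- Rows are scaled by `γ` and `-c`, and the first columns by `γ⁻¹`. The vertical pencil needs `c =
1`, the circular one `c = exp (i θ)`. -/
theorem Matrix.det_fromBlocks_smul_eq_zero_iff {k : ℕ} (A P Q D : Matrix (Fin k) (Fin k) ℂ)
    {γ c : ℂ} (hγ : γ ≠ 0) (hc : c ≠ 0) :
    (Matrix.fromBlocks A (γ • P) (-((c * γ) • Q)) (-(c • D))).det = 0 ↔
      (Matrix.fromBlocks A P ((γ ^ 2) • Q) D).det = 0 := by
  have h : Matrix.fromBlocks A (γ • P) (-((c * γ) • Q)) (-(c • D)) =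
      Matrix.fromBlocks (γ • (1 : Matrix (Fin k) (Fin k) ℂ)) 0 0
        ((-c) • (1 : Matrix (Fin k) (Fin k) ℂ)) * Matrix.fromBlocks A P ((γ ^ 2) • Q) D *
      Matrix.fromBlocks (γ⁻¹ • (1 : Matrix (Fin k) (Fin k) ℂ)) 0 0 1 := by
    simp only [Matrix.fromBlocks_multiply]
    congr 1
    · simp [smul_smul, hγ]
    · simp
    · simp only [Matrix.zero_mul, Matrix.smul_mul, Matrix.mul_smul, Matrix.mul_zero, zero_add,
        add_zero, Matrix.one_mul, Matrix.mul_one, smul_smul, ← neg_smul]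
      congr 1
      field_simp
    · simp
  rw [h, Matrix.det_mul, Matrix.det_mul, Matrix.det_fromBlocks_zero₁₂,
    Matrix.det_fromBlocks_zero₁₂, Matrix.det_smul, Matrix.det_smul, Matrix.det_smul]
  simp [hγ, hc]

namespace LTISystem

variable {n m p : ℕ} (S : LTISystem n m p)

theorem isUnit_R {γ : ℝ} (hD : ‖S.D‖ < γ) : IsUnit (S.R γ) := by
  rw [Matrix.isUnit_iff_det_ne_zero, R, ← neg_sub, Matrix.det_neg]
  exact mul_ne_zero (by simp) (S.D.det_sq_sub_conjTranspose_mul_self_ne_zero hD)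

theorem isUnit_Sm {γ : ℝ} (hD : ‖S.D‖ < γ) : IsUnit (S.Sm γ) := by
  rw [Matrix.isUnit_iff_det_ne_zero, Sm, ← neg_sub, Matrix.det_neg]
  have := S.Dᴴ.det_sq_sub_conjTranspose_mul_self_ne_zero (γ := γ)
    (by rwa [Matrix.l2_opNorm_conjTranspose])
  rw [Matrix.conjTranspose_conjTranspose] at this
  exact mul_ne_zero (by simp) this

theorem conjTranspose_R_inv (γ : ℝ) : ((S.R γ)⁻¹)ᴴ = (S.R γ)⁻¹ := by
  rw [Matrix.conjTranspose_nonsing_inv]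
  congr 1
  simp [R, Matrix.conjTranspose_smul]

/-- A consequence of `S.Sm γ * D = D * S.R γ`; it produces the `S⁻¹` in the lower left block of the
Schur complement. -/
theorem D_mul_R_inv_mul {γ : ℝ} (hD : ‖S.D‖ < γ) :
    S.D * (S.R γ)⁻¹ * S.Dᴴ - 1 = ((γ ^ 2 : ℝ) : ℂ) • (S.Sm γ)⁻¹ := by
  have hR := (Matrix.isUnit_iff_isUnit_det _).1 (S.isUnit_R hD)
  have hS := (Matrix.isUnit_iff_isUnit_det _).1 (S.isUnit_Sm hD)
  have h1 : S.Sm γ * S.D = S.D * S.R γ := by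
    simp [Sm, R, Matrix.sub_mul, Matrix.mul_sub, Matrix.mul_assoc]
  have h2 : S.Sm γ * (S.D * (S.R γ)⁻¹) = S.D := by
    rw [← Matrix.mul_assoc, h1, Matrix.mul_assoc, Matrix.mul_nonsing_inv _ hR, Matrix.mul_one]
  have h3 : S.Sm γ * (S.D * (S.R γ)⁻¹ * S.Dᴴ - 1) = ((γ ^ 2 : ℝ) : ℂ) • 1 := by
    rw [Matrix.mul_sub, ← Matrix.mul_assoc, h2, Matrix.mul_one, Sm, sub_sub_cancel]
  calc S.D * (S.R γ)⁻¹ * S.Dᴴ - 1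
      = (S.Sm γ)⁻¹ * (S.Sm γ * (S.D * (S.R γ)⁻¹ * S.Dᴴ - 1)) := by
        rw [← Matrix.mul_assoc, Matrix.nonsing_inv_mul _ hS, Matrix.one_mul]
    _ = _ := by rw [h3, Matrix.mul_smul, Matrix.mul_one]

/-- Elimination of the input variables. -/
theorem svDet_sq_eq_zero_iff {γ : ℝ} (hD : ‖S.D‖ < γ) (z v : ℂ) :
    S.svDet (RingHom.id ℂ) z 1 v ((γ ^ 2 : ℝ) : ℂ) = 0 ↔
      (Matrix.fromBlocks (z • S.E - (S.A - S.B * (S.R γ)⁻¹ * S.Dᴴ * S.C))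
        (S.B * (S.R γ)⁻¹ * S.Bᴴ) (((γ : ℂ) ^ 2) • (S.Cᴴ * (S.Sm γ)⁻¹ * S.C))
        (v • S.Eᴴ - (S.Aᴴ - S.Cᴴ * S.D * (S.R γ)⁻¹ * S.Bᴴ))).det = 0 := by
  have hR := (Matrix.isUnit_iff_isUnit_det _).1 (S.isUnit_R hD)
  have hneg : ((γ ^ 2 : ℝ) : ℂ) • 1 - S.Dᴴ * S.D = -S.R γ := by rw [R, neg_sub]
  rw [svDet_eq_det, hneg]
  let i1 : Invertible (S.R γ) := (S.R γ).invertibleOfIsUnitDet hR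
  let i2 : Invertible (-S.R γ) := invertibleNeg _
  have hinv : ⅟(-S.R γ) = -(S.R γ)⁻¹ := by rw [invOf_neg, Matrix.invOf_eq_nonsing_inv]
  rw [Matrix.det_fromBlocks₂₂, hinv, Matrix.fromRows_mul, Matrix.fromRows_mul_fromCols]
  have hne : (-S.R γ).det ≠ 0 := by
    rw [Matrix.det_neg]; exact mul_ne_zero (by simp) hR.ne_zero
  rw [mul_eq_zero, or_iff_right hne, sub_eq_add_neg, Matrix.fromBlocks_neg, Matrix.fromBlocks_add]
  have hkey : ((γ : ℂ) ^ 2) • (S.Cᴴ * (S.Sm γ)⁻¹ * S.C) =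
      S.Cᴴ * (S.D * (S.R γ)⁻¹ * S.Dᴴ - 1) * S.C := by
    rw [S.D_mul_R_inv_mul hD]; simp
  rw [hkey]
  refine Iff.of_eq (congrArg (fun M : Matrix (Fin n ⊕ Fin n) (Fin n ⊕ Fin n) ℂ => M.det = 0) ?_)
  congr 1
  · simp only [Matrix.neg_mul, Matrix.mul_neg, neg_neg, Matrix.mul_assoc]; abel
  · simp only [Matrix.neg_mul, Matrix.mul_neg, neg_neg, Matrix.mul_assoc]; abel
  · simp only [Matrix.neg_mul, Matrix.mul_neg, neg_neg, Matrix.mul_assoc, one_smul,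
      Matrix.mul_sub, Matrix.sub_mul, Matrix.one_mul]; abel
  · simp only [Matrix.neg_mul, Matrix.mul_neg, neg_neg, Matrix.mul_assoc, one_smul]; abel

theorem mem_vertEigs {ε x y : ℝ} (hε : 0 < ε) (hD : ‖S.D‖ < ε⁻¹) :
    y ∈ S.vertEigs ε x ↔ S.svDet (RingHom.id ℂ) (x + y * Complex.I) 1
      (starRingEnd ℂ (x + y * Complex.I)) ((ε⁻¹ ^ 2 : ℝ) : ℂ) = 0 := by
  have hγ : ((ε⁻¹ : ℝ) : ℂ) ≠ 0 := by exact_mod_cast (inv_pos.2 hε).ne'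
  rw [S.svDet_sq_eq_zero_iff hD, ← Matrix.det_fromBlocks_smul_eq_zero_iff _ _ _ _ hγ one_ne_zero,
    vertEigs, Set.mem_ofPred_eq, pencilSpec, Set.mem_ofPred_eq]
  refine Iff.of_eq (congrArg (fun M : Matrix (Fin n ⊕ Fin n) (Fin n ⊕ Fin n) ℂ => M.det = 0) ?_)
  rw [contN, contM, Matrix.fromBlocks_smul, sub_eq_add_neg, Matrix.fromBlocks_neg,
    Matrix.fromBlocks_add]
  congr 1
  · rw [add_smul]; abel
  · simp
  · simp
  · simp only [Matrix.conjTranspose_sub, Matrix.conjTranspose_mul, Matrix.conjTranspose_smul,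
      Matrix.conjTranspose_conjTranspose, S.conjTranspose_R_inv, Matrix.mul_assoc, one_smul,
      map_add, map_mul, Complex.conj_ofReal, Complex.conj_I, add_smul, mul_neg, neg_smul,
      Complex.star_def]
    abel

theorem mem_circEigs {ε r θ : ℝ} (hε : 0 < ε) (hD : ‖S.D‖ < ε⁻¹) :
    θ ∈ S.circEigs ε r ↔ S.svDet (RingHom.id ℂ) (polarPt r θ) 1
      (starRingEnd ℂ (polarPt r θ)) ((ε⁻¹ ^ 2 : ℝ) : ℂ) = 0 := by
  have hγ : ((ε⁻¹ : ℝ) : ℂ) ≠ 0 := by exact_mod_cast (inv_pos.2 hε).ne'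
  set w := Complex.exp (θ * Complex.I) with hw
  have hw0 : w ≠ 0 := Complex.exp_ne_zero _
  have hpol : polarPt r θ = r * w := rfl
  have hconj : w * starRingEnd ℂ (polarPt r θ) = r := by
    rw [hpol, map_mul, Complex.conj_ofReal, mul_left_comm, Complex.mul_conj, hw,
      Complex.normSq_eq_norm_sq, Complex.norm_exp_ofReal_mul_I]
    simp
  rw [S.svDet_sq_eq_zero_iff hD, ← Matrix.det_fromBlocks_smul_eq_zero_iff _ _ _ _ hγ hw0,
    circEigs, Set.mem_ofPred_eq, pencilSpec, Set.mem_ofPred_eq, ← hw]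
  refine Iff.of_eq (congrArg (fun M : Matrix (Fin n ⊕ Fin n) (Fin n ⊕ Fin n) ℂ => M.det = 0) ?_)
  rw [discT, discS, Matrix.fromBlocks_smul, sub_eq_add_neg, Matrix.fromBlocks_neg,
    Matrix.fromBlocks_add]
  congr 1
  · rw [smul_smul, hpol, mul_comm, ← sub_eq_add_neg]
  · simp
  · simp [smul_smul]
  · rw [smul_sub w (_ • _), smul_smul, hconj, neg_sub, ← sub_eq_add_neg]

/-! ### The singular value determinant as a polynomial -/

/-- Complex numbers as constant polynomials in three variables. -/
noncomputable def constHom : ℂ →+* Polynomial (Polynomial (Polynomial ℂ)) :=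
  (Polynomial.C.comp Polynomial.C).comp Polynomial.C

/-- The singular value determinant on vertical lines, with `z = x + w`. -/
noncomputable def vertPoly : Polynomial (Polynomial (Polynomial ℂ)) :=
  S.svDet constHom
    (Polynomial.C (Polynomial.C Polynomial.X) + Polynomial.X) 1
    (Polynomial.C (Polynomial.C Polynomial.X) - Polynomial.X) (Polynomial.C Polynomial.X)

/-- The singular value determinant on circles, with `z = x * w`. -/
noncomputable def circPoly : Polynomial (Polynomial (Polynomial ℂ)) :=
  S.svDet constHom
    (Polynomial.C (Polynomial.C Polynomial.X) * Polynomial.X) Polynomial.X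
    (Polynomial.C (Polynomial.C Polynomial.X)) (Polynomial.C Polynomial.X)

theorem eval₂_vertPoly (x w s : ℂ) :
    S.vertPoly.eval₂ (Polynomial.evalEvalRingHom x s) w =
      S.svDet (RingHom.id ℂ) (x + w) 1 (x - w) s := by
  have hc : (Polynomial.eval₂RingHom (Polynomial.evalEvalRingHom x s) w).comp
      constHom = RingHom.id ℂ := by
    ext a; simp [constHom]
  have := S.map_svDet (R := Polynomial (Polynomial (Polynomial ℂ))) (T := ℂ) constHom
    (Polynomial.eval₂RingHom (Polynomial.evalEvalRingHom x s) w)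
    (Polynomial.C (Polynomial.C Polynomial.X) + Polynomial.X) 1
    (Polynomial.C (Polynomial.C Polynomial.X) - Polynomial.X) (Polynomial.C Polynomial.X)
  rw [hc] at this
  simpa [vertPoly, -RingHom.id_apply] using this

theorem eval₂_circPoly (x w s : ℂ) :
    S.circPoly.eval₂ (Polynomial.evalEvalRingHom x s) w =
      S.svDet (RingHom.id ℂ) (x * w) w x s := by
  have hc : (Polynomial.eval₂RingHom (Polynomial.evalEvalRingHom x s) w).comp
      constHom = RingHom.id ℂ := by
    ext a; simp [constHom]
  have := S.map_svDet (R := Polynomial (Polynomial (Polynomial ℂ))) (T := ℂ) constHom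
    (Polynomial.eval₂RingHom (Polynomial.evalEvalRingHom x s) w)
    (Polynomial.C (Polynomial.C Polynomial.X) * Polynomial.X) Polynomial.X
    (Polynomial.C (Polynomial.C Polynomial.X)) (Polynomial.C Polynomial.X)
  rw [hc] at this
  simpa [circPoly, -RingHom.id_apply] using this

theorem eval₂_vertPoly_I (x y : ℝ) (s : ℂ) :
    S.vertPoly.eval₂ (Polynomial.evalEvalRingHom (x : ℂ) s) (y * Complex.I) =
      S.svDet (RingHom.id ℂ) (x + y * Complex.I) 1 (starRingEnd ℂ (x + y * Complex.I)) s := by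
  rw [eval₂_vertPoly]
  simp [sub_eq_add_neg]

theorem eval₂_circPoly_exp (r θ : ℝ) (s : ℂ) :
    S.circPoly.eval₂ (Polynomial.evalEvalRingHom (r : ℂ) s) (Complex.exp (θ * Complex.I)) =
      Complex.exp (θ * Complex.I) ^ n *
        S.svDet (RingHom.id ℂ) (polarPt r θ) 1 (starRingEnd ℂ (polarPt r θ)) s := by
  rw [eval₂_circPoly, ← svDet_smul]
  congr 1
  rw [polarPt, map_mul, Complex.conj_ofReal, mul_left_comm, Complex.mul_conj,
      Complex.normSq_eq_norm_sq, Complex.norm_exp_ofReal_mul_I]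
  simp

theorem continuous_svDet : Continuous fun q : ℂ × ℂ × ℂ =>
    S.svDet (RingHom.id ℂ) q.1 1 q.2.1 q.2.2 := by
  simp only [svDet]
  refine Continuous.matrix_det ?_
  fun_prop

/-- The extended norm of the transfer function is a root of the singular value determinant. -/
theorem svDet_of_ntf_eq (hE : IsUnit S.E) {z : ℂ} {σ : ℝ} (hσ : 0 < σ) (h : S.ntf z = σ) :
    S.svDet (RingHom.id ℂ) z 1 (starRingEnd ℂ z) ((σ ^ 2 : ℝ) : ℂ) = 0 := by
  obtain ⟨h', -⟩ | ⟨G, hG, hGn⟩ := S.tendsto_transfer z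
  · rw [h] at h'; simp at h'
  · have hσG : σ = ‖G‖ := by rw [hGn] at h; exact_mod_cast h.symm
    -- The elimination of the states is not available at a removable singularity, so the identity is
    -- passed to the limit.
    have hlim : Tendsto (fun w => S.svDet (RingHom.id ℂ) w 1 (starRingEnd ℂ w)
        ((‖S.transfer w‖ ^ 2 : ℝ) : ℂ)) (𝓝[≠] z)
        (𝓝 (S.svDet (RingHom.id ℂ) z 1 (starRingEnd ℂ z) ((σ ^ 2 : ℝ) : ℂ))) := by
      have hid : Tendsto (fun w : ℂ => w) (𝓝[≠] z) (𝓝 z) := nhdsWithin_le_nhds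
      refine (S.continuous_svDet.tendsto (z, starRingEnd ℂ z, ((σ ^ 2 : ℝ) : ℂ))).comp
        (f := fun w : ℂ => (w, starRingEnd ℂ w, ((‖S.transfer w‖ ^ 2 : ℝ) : ℂ))) ?_
      refine hid.prodMk_nhds (((Complex.continuous_conj.tendsto z).comp hid).prodMk_nhds ?_)
      rw [hσG]
      exact (Complex.continuous_ofReal.tendsto _).comp (hG.norm.pow 2)
    refine tendsto_nhds_unique hlim (Tendsto.congr' ?_ tendsto_const_nhds)
    have hpos : ∀ᶠ w in 𝓝[≠] z, 0 < ‖S.transfer w‖ :=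
      hG.norm.eventually (lt_mem_nhds (by rwa [← hσG]))
    filter_upwards [hpos, S.eventually_notMem_eig hE z] with w hw hwE
    rw [S.svDet_eq_of_notMem hwE, Matrix.det_norm_sq_sub_conjTranspose_mul_self _ hw, mul_zero]

theorem svDet_ne_zero {z : ℂ} {γ : ℝ} (hz : z ∉ S.eig) (h : S.ntf z < γ) :
    S.svDet (RingHom.id ℂ) z 1 (starRingEnd ℂ z) ((γ ^ 2 : ℝ) : ℂ) ≠ 0 := by
  have hdet : (z • S.E - S.A).det ≠ 0 := hz
  rw [S.ntf_of_notMem hz, EReal.coe_lt_coe_iff] at h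
  rw [S.svDet_eq_of_notMem hz, Matrix.det_conjTranspose]
  exact mul_ne_zero (mul_ne_zero hdet (star_ne_zero.2 hdet))
    (Matrix.det_sq_sub_conjTranspose_mul_self_ne_zero _ h)

end LTISystem

namespace LTISystem

variable {n m p : ℕ} (S : LTISystem n m p)

/-! ### The spectral value set as a superlevel set -/

/-- Sylvester's identity `det (1 - XY) = det (1 - YX)` moves the perturbation from the state space
to the output space. -/
theorem det_sub_pert_mul {z : ℂ} (hz : z ∉ S.eig) (Δ : Matrix (Fin m) (Fin p) ℂ)
    (hΔ : IsUnit (1 - S.D * Δ)) :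
    (z • S.E - S.pert Δ).det * (1 - S.D * Δ).det =
      (z • S.E - S.A).det * (1 - S.transfer z * Δ).det := by
  have hX := (Matrix.isUnit_iff_isUnit_det _).1 (S.notMem_eig_iff.1 hz)
  have hW := (Matrix.isUnit_iff_isUnit_det _).1 hΔ
  set X := z • S.E - S.A with hXdef
  set W := 1 - S.D * Δ with hWdef
  have h1 : z • S.E - S.pert Δ = X * (1 - X⁻¹ * S.B * (Δ * W⁻¹ * S.C)) := by
    rw [Matrix.mul_sub, Matrix.mul_one, ← Matrix.mul_assoc, ← Matrix.mul_assoc X,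
      Matrix.mul_nonsing_inv _ hX, Matrix.one_mul, pert, hXdef, ← hWdef, sub_add_eq_sub_sub]
    simp only [Matrix.mul_assoc]
  have h2 : (1 - Δ * W⁻¹ * S.C * (X⁻¹ * S.B)).det = (1 - S.C * (X⁻¹ * S.B) * (Δ * W⁻¹)).det := by
    rw [Matrix.mul_assoc (Δ * W⁻¹), Matrix.det_one_sub_mul_comm]
  have h3 : (1 - S.C * (X⁻¹ * S.B) * (Δ * W⁻¹)) * W = 1 - S.transfer z * Δ := by
    rw [Matrix.sub_mul, Matrix.one_mul, Matrix.mul_assoc, Matrix.mul_assoc Δ,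
      Matrix.nonsing_inv_mul _ hW, Matrix.mul_one, hWdef, transfer, Matrix.add_mul,
      sub_sub, add_comm (S.D * Δ), ← hXdef]
    simp only [Matrix.mul_assoc]
  rw [h1, Matrix.det_mul, Matrix.det_one_sub_mul_comm, h2, mul_assoc, ← Matrix.det_mul, h3]

theorem mem_svs_iff_of_notMem {ε : ℝ} (hε : 0 < ε) (hD : ‖S.D‖ < ε⁻¹) {z : ℂ} (hz : z ∉ S.eig) :
    z ∈ S.svs ε ↔ ε⁻¹ ≤ ‖S.transfer z‖ := by
  have hunit : ∀ Δ : Matrix (Fin m) (Fin p) ℂ, ‖Δ‖ ≤ ε → IsUnit (1 - S.D * Δ) := by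
    intro Δ hΔ
    refine isUnit_one_sub_of_norm_lt_one ((Matrix.l2_opNorm_mul _ _).trans_lt ?_)
    calc ‖S.D‖ * ‖Δ‖ ≤ ‖S.D‖ * ε := by gcongr
      _ < ε⁻¹ * ε := by gcongr
      _ = 1 := inv_mul_cancel₀ hε.ne'
  have hdetX : (z • S.E - S.A).det ≠ 0 := hz
  have key : ∀ Δ : Matrix (Fin m) (Fin p) ℂ, ‖Δ‖ ≤ ε →
      ((z • S.E - S.pert Δ).det = 0 ↔ (1 - S.transfer z * Δ).det = 0) := by
    intro Δ hΔ
    have h1 := S.det_sub_pert_mul hz Δ (hunit Δ hΔ)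
    have h2 := (Matrix.isUnit_iff_det_ne_zero _).1 (hunit Δ hΔ)
    constructor <;> intro h
    · rw [h, zero_mul] at h1
      exact (mul_eq_zero.1 h1.symm).resolve_left hdetX
    · rw [h, mul_zero] at h1
      exact (mul_eq_zero.1 h1).resolve_right h2
  constructor
  · rintro ⟨Δ, hΔ, hdet⟩
    by_contra! hlt
    refine (Matrix.isUnit_iff_det_ne_zero _).1
      (isUnit_one_sub_of_norm_lt_one ((Matrix.l2_opNorm_mul (S.transfer z) Δ).trans_lt ?_))
      ((key Δ hΔ).1 hdet)
    calc ‖S.transfer z‖ * ‖Δ‖ ≤ ‖S.transfer z‖ * ε := by gcongr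
      _ < ε⁻¹ * ε := by gcongr
      _ = 1 := inv_mul_cancel₀ hε.ne'
  · intro hle
    set G := S.transfer z with hG
    have hpos : 0 < ‖G‖ := (inv_pos.2 hε).trans_le hle
    -- The witness is `Δ = Gᴴ / ‖G‖²`: its norm is `1 / ‖G‖ ≤ ε`, and `G Δ` has the eigenvalue 1.
    set c : ℂ := ((‖G‖ ^ 2 : ℝ) : ℂ) with hc
    have hc0 : c ≠ 0 := by rw [hc]; exact_mod_cast (pow_pos hpos 2).ne'
    have hΔ : ‖c⁻¹ • Gᴴ‖ ≤ ε := by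
      rw [norm_smul, Matrix.l2_opNorm_conjTranspose, norm_inv, hc, Complex.norm_real,
        Real.norm_of_nonneg (by positivity), sq, mul_inv, mul_assoc, inv_mul_cancel₀ hpos.ne',
        mul_one]
      exact inv_le_of_inv_le₀ hε hle
    refine ⟨c⁻¹ • Gᴴ, hΔ, (key _ hΔ).2 ?_⟩
    have h0 := Matrix.det_norm_sq_sub_conjTranspose_mul_self Gᴴ
      (by rwa [Matrix.l2_opNorm_conjTranspose])
    rw [Matrix.l2_opNorm_conjTranspose, Matrix.conjTranspose_conjTranspose, ← hc] at h0
    have h1 : 1 - G * (c⁻¹ • Gᴴ) = c⁻¹ • (c • 1 - G * Gᴴ) := by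
      rw [smul_sub, smul_smul, inv_mul_cancel₀ hc0, one_smul, Matrix.mul_smul]
    rw [h1, Matrix.det_smul, h0, mul_zero]

theorem eig_subset_svs {ε : ℝ} (hε : 0 < ε) : S.eig ⊆ S.svs ε := fun z hz =>
  ⟨0, by simpa using hε.le, by simpa [pert, eig] using hz⟩

theorem mem_svs_iff {ε : ℝ} (hε : 0 < ε) (hD : ‖S.D‖ < ε⁻¹) {z : ℂ} :
    z ∈ S.svs ε ↔ z ∈ S.eig ∨ ((ε⁻¹ : ℝ) : EReal) ≤ S.ntf z := by
  by_cases hz : z ∈ S.eig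
  · simp [hz, S.eig_subset_svs hε hz]
  · rw [S.mem_svs_iff_of_notMem hε hD hz, S.ntf_of_notMem hz, EReal.coe_le_coe_iff]
    simp [hz]

theorem isCompact_svs (hE : IsUnit S.E) {ε : ℝ} (hε : 0 < ε) (hD : ‖S.D‖ < ε⁻¹) :
    IsCompact (S.svs ε) := by
  have heq : S.svs ε = S.eig ∪ S.ntf ⁻¹' Set.Ici ((ε⁻¹ : ℝ) : EReal) := by
    ext z; exact S.mem_svs_iff hε hD
  refine Metric.isCompact_of_isClosed_isBounded ?_ ?_
  · rw [heq]
    exact (S.finite_eig hE).isClosed.union (isClosed_Ici.preimage (S.continuous_ntf hE))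
  · obtain ⟨M, hM⟩ := S.exists_forall_ntf_lt hE hD
    refine (Metric.isBounded_closedBall (x := (0 : ℂ)) (r := M)).subset fun z hz => ?_
    rw [mem_closedBall_zero_iff]
    by_contra! h
    obtain ⟨h1, h2⟩ := hM z h.le
    exact ((S.mem_svs_iff hε hD).1 hz).elim h1 fun h3 => h3.not_gt h2

/-- A point of the spectral value set that is not isolated lies in the superlevel set. -/
theorem le_ntf_of_not_isolated (hE : IsUnit S.E) {ε : ℝ} (hε : 0 < ε) (hD : ‖S.D‖ < ε⁻¹) {z : ℂ}
    (hz : z ∈ S.svs ε) (hiso : ¬ IsIsolatedPoint (S.svs ε) z) :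
    ((ε⁻¹ : ℝ) : EReal) ≤ S.ntf z := by
  by_contra! hlt
  refine hiso ⟨{w | S.ntf w < ((ε⁻¹ : ℝ) : EReal)} ∩ {w | w = z ∨ w ∉ S.eig}, ?_, ?_⟩
  · refine inter_mem ((S.continuous_ntf hE).continuousAt.eventually (gt_mem_nhds hlt)) ?_
    have := eventually_nhdsWithin_iff.1 (S.eventually_notMem_eig hE z)
    filter_upwards [this] with w hw
    by_cases h : w = z
    · exact Or.inl h
    · exact Or.inr (hw h)
  · ext w
    constructor
    · rintro ⟨hw, hw1, hw2⟩
      rcases hw2 with h | h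
      · exact h
      · exact absurd ((S.mem_svs_iff hε hD).1 hw) (not_or.2 ⟨h, not_le.2 hw1⟩)
    · rintro rfl
      exact ⟨hz, hlt, Or.inl rfl⟩

/-! ### Vertical lines -/

/-- Far out on the line `g < ε⁻¹`, so the determinant is not identically zero in `w = iy`. A circle
is bounded and allows no such argument. -/
theorem finite_vertEigs (hE : IsUnit S.E) {ε : ℝ} (hε : 0 < ε) (hD : ‖S.D‖ < ε⁻¹) (x : ℝ) :
    (S.vertEigs ε x).Finite := by
  obtain ⟨M, hM⟩ := S.exists_forall_ntf_lt hE hD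
  set f := S.vertPoly.map (Polynomial.evalEvalRingHom (x : ℂ) ((ε⁻¹ ^ 2 : ℝ) : ℂ)) with hf
  have hfy : ∀ y : ℝ, f.eval (y * Complex.I) = S.svDet (RingHom.id ℂ) (x + y * Complex.I) 1
      (starRingEnd ℂ (x + y * Complex.I)) ((ε⁻¹ ^ 2 : ℝ) : ℂ) := fun y => by
    rw [hf, Polynomial.eval_map, S.eval₂_vertPoly_I]
  have hf0 : f ≠ 0 := by
    intro h0
    have hb : M ≤ ‖(x + (|M| : ℝ) * Complex.I : ℂ)‖ := by
      refine (le_abs_self M).trans ?_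
      have := Complex.abs_im_le_norm (x + (|M| : ℝ) * Complex.I : ℂ)
      simpa using this
    obtain ⟨h1, h2⟩ := hM _ hb
    have := hfy |M|
    rw [h0, Polynomial.eval_zero] at this
    exact S.svDet_ne_zero h1 h2 this.symm
  refine ((Polynomial.finite_setOfPred_isRoot hf0).preimage
    (f := fun y : ℝ => (y * Complex.I : ℂ)) ?_).subset fun y hy => ?_
  · intro a _ b _ hab
    simpa using hab
  · rw [S.mem_vertEigs hε hD] at hy
    exact (hfy y).trans hy

theorem mem_vertEigs_of_ntf_eq (hE : IsUnit S.E) {ε : ℝ} (hε : 0 < ε) (hD : ‖S.D‖ < ε⁻¹)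
    {x y : ℝ} (h : S.ntf (x + y * Complex.I) = ((ε⁻¹ : ℝ) : EReal)) : y ∈ S.vertEigs ε x :=
  (S.mem_vertEigs hε hD).2 (S.svDet_of_ntf_eq hE (inv_pos.2 hε) h)

/-! ### Consequences of the maximum principle -/

/-- Otherwise `z` is a local maximum of the norm, which is then constantly `ε⁻¹` near `z`; a whole
segment of a vertical line would consist of the finitely many search eigenvalues. -/
theorem mem_closure_superlevel (hE : IsUnit S.E) {ε : ℝ} (hε : 0 < ε) (hD : ‖S.D‖ < ε⁻¹) {z : ℂ}
    (hz : ((ε⁻¹ : ℝ) : EReal) ≤ S.ntf z) : z ∈ closure {w | ((ε⁻¹ : ℝ) : EReal) < S.ntf w} := by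
  by_contra hcl
  have hle : ∀ᶠ w in 𝓝 z, S.ntf w ≤ ((ε⁻¹ : ℝ) : EReal) := by
    filter_upwards [isClosed_closure.isOpen_compl.mem_nhds hcl] with w hw
    exact not_lt.1 fun h => hw (subset_closure h)
  have hfin : ∀ᶠ w in 𝓝 z, S.ntf w ≠ ⊤ := by
    filter_upwards [hle] with w hw h
    rw [h] at hw
    exact (EReal.coe_lt_top _).not_ge hw
  have hzeq : S.ntf z = ((ε⁻¹ : ℝ) : EReal) := le_antisymm hle.self_of_nhds hz
  have hmax : IsLocalMax (norm ∘ S.transferExt) z := by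
    filter_upwards [hle, hfin] with w hw hwt
    rw [← hzeq, S.norm_transferExt hwt, S.norm_transferExt hfin.self_of_nhds,
      EReal.coe_le_coe_iff] at hw
    exact hw
  have hconst := Complex.norm_eventually_eq_of_isLocalMax
    (hfin.mono fun w hw => S.differentiableAt_transferExt hE hw) hmax
  have hall : ∀ᶠ w in 𝓝 z, S.ntf w = ((ε⁻¹ : ℝ) : EReal) := by
    filter_upwards [hconst, hfin] with w hw hwt
    rw [S.norm_transferExt hwt, hw, ← S.norm_transferExt hfin.self_of_nhds, hzeq]
  have hline : ∀ᶠ y in 𝓝 z.im, S.ntf ((z.re : ℂ) + (y : ℝ) * Complex.I) = ((ε⁻¹ : ℝ) : EReal) := by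
    have hc : ContinuousAt (fun y : ℝ => ((z.re : ℂ) + (y : ℝ) * Complex.I)) z.im := by fun_prop
    have hc' : Tendsto (fun y : ℝ => ((z.re : ℂ) + (y : ℝ) * Complex.I)) (𝓝 z.im) (𝓝 z) := by
      simpa [ContinuousAt, Complex.re_add_im] using hc
    exact hc'.eventually hall
  refine (Set.Infinite.mono (fun y hy => S.mem_vertEigs_of_ntf_eq hE hε hD hy)
    (infinite_of_mem_nhds z.im hline)) (S.finite_vertEigs hE hε hD z.re)

/-- Every component of the open superlevel set contains a pole of the transfer function. -/
theorem exists_pole_mem_component (hE : IsUnit S.E) {ε : ℝ} (hD : ‖S.D‖ < ε⁻¹)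
    {z : ℂ} (hz : ((ε⁻¹ : ℝ) : EReal) < S.ntf z) :
    ∃ w ∈ connectedComponentIn {w | ((ε⁻¹ : ℝ) : EReal) < S.ntf w} z, S.ntf w = ⊤ := by
  set W : Set ℂ := {w | ((ε⁻¹ : ℝ) : EReal) < S.ntf w} with hW
  have hWo : IsOpen W := isOpen_Ioi.preimage (S.continuous_ntf hE)
  set V := connectedComponentIn W z with hV
  have hVo : IsOpen V := hWo.connectedComponentIn
  have hzV : z ∈ V := mem_connectedComponentIn hz
  have hVW : V ⊆ W := connectedComponentIn_subset W z
  by_contra! hno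
  -- A frontier point with larger value would have its own open component, which meets `V` and so
  -- equals it. Without poles, the maximum modulus principle on `V` then contradicts the value at
  -- `z`.
  have hfront : ∀ w ∈ frontier V, S.ntf w ≤ ((ε⁻¹ : ℝ) : EReal) := by
    intro w hw
    by_contra! hlt
    have hwo : IsOpen (connectedComponentIn W w) := hWo.connectedComponentIn
    obtain ⟨v, hv1, hv2⟩ := mem_closure_iff.1 hw.1 _ hwo (mem_connectedComponentIn hlt)
    have e1 := connectedComponentIn_eq hv1
    have e2 := connectedComponentIn_eq hv2
    have hwV : w ∈ V := by rw [hV, e2, ← e1]; exact mem_connectedComponentIn hlt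
    rw [hVo.frontier_eq] at hw
    exact hw.2 hwV
  have hcl : ∀ w ∈ closure V, S.ntf w ≠ ⊤ := by
    intro w hw
    rw [closure_eq_self_union_frontier] at hw
    rcases hw with hw | hw
    · exact hno w hw
    · exact ((hfront w hw).trans_lt (EReal.coe_lt_top _)).ne
  have hbdd : Bornology.IsBounded V := by
    obtain ⟨M, hM⟩ := S.exists_forall_ntf_lt hE hD
    refine (Metric.isBounded_closedBall (x := (0 : ℂ)) (r := M)).subset fun w hw => ?_
    rw [mem_closedBall_zero_iff]
    by_contra! h
    exact (hM w h.le).2.not_gt (hVW hw)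
  have hle := Complex.norm_le_of_forall_mem_frontier_norm_le hbdd
    (DifferentiableOn.diffContOnCl (𝕜 := ℂ) (f := S.transferExt) fun w hw =>
      (S.differentiableAt_transferExt hE (hcl w hw)).differentiableWithinAt)
    (C := ε⁻¹) (fun w hw => by
      have := hfront w hw
      rwa [S.norm_transferExt (hcl w (frontier_subset_closure hw)), EReal.coe_le_coe_iff] at this)
    (subset_closure hzV)
  rw [S.norm_transferExt (hno z hzV), EReal.coe_lt_coe_iff] at hz
  exact hz.not_ge hle

theorem mem_selection_of_ntf_eq_top {Λ : Set ℂ} (hΛ : S.IsSelection Λ) {z : ℂ}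
    (hz : S.ntf z = ⊤) : z ∈ Λ := by
  by_contra h
  by_cases hzE : z ∈ S.eig
  · exact (hΛ.2 z hzE h).2 hz
  · rw [S.ntf_of_notMem hzE] at hz
    exact EReal.coe_ne_top _ hz

/-- All level sets of `f` between the selected eigenvalues and a point of the superlevel set meet
the open superlevel set. -/
theorem exists_superlevel_of_between (hE : IsUnit S.E) {ε : ℝ} (hε : 0 < ε) (hD : ‖S.D‖ < ε⁻¹)
    {Λ : Set ℂ} (hΛ : S.IsSelection Λ) {f : ℂ → ℝ} (hf : Continuous f) {t : ℝ}
    (ht : ∀ w ∈ Λ, f w ≤ t) {z : ℂ} (hz : ((ε⁻¹ : ℝ) : EReal) ≤ S.ntf z) (htz : t < f z) :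
    ∃ w, ((ε⁻¹ : ℝ) : EReal) < S.ntf w ∧ f w = t := by
  obtain ⟨v, hv, hvW⟩ := mem_closure_iff.1 (S.mem_closure_superlevel hE hε hD hz) _
    (isOpen_Ioi.preimage hf) htz
  obtain ⟨w, hw, hwtop⟩ := S.exists_pole_mem_component hE hD hvW
  obtain ⟨u, hu, hfu⟩ := isPreconnected_connectedComponentIn.intermediate_value hw
    (mem_connectedComponentIn hvW) hf.continuousOn
    ⟨ht w (S.mem_selection_of_ntf_eq_top hΛ hwtop), le_of_lt hv⟩
  have huW := connectedComponentIn_subset _ _ hu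
  exact ⟨u, huW, hfu⟩

theorem exists_isMaxOn_svs (hn : 0 < n) (hE : IsUnit S.E) {ε : ℝ} (hε : 0 < ε)
    (hD : ‖S.D‖ < ε⁻¹) {f : ℂ → ℝ} (hf : Continuous f) :
    ∃ w ∈ S.svs ε, IsGreatest (f '' S.svs ε) (f w) := by
  obtain ⟨w, hw, hmax⟩ := (S.isCompact_svs hE hε hD).exists_isMaxOn
    ((S.nonempty_eig hn hE).mono (S.eig_subset_svs hε)) hf.continuousOn
  exact ⟨w, hw, ⟨w, hw, rfl⟩, by rintro _ ⟨v, hv, rfl⟩; exact hmax hv⟩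

/-- If the isolated points left out are dominated, the maximum of `f` over the spectral value set
is attained at a selected eigenvalue or at a point of the superlevel set. -/
theorem exists_max_selected_or_le_ntf (hn : 0 < n) (hE : IsUnit S.E) {ε : ℝ} (hε : 0 < ε)
    (hD : ‖S.D‖ < ε⁻¹) {Λ : Set ℂ} {f : ℂ → ℝ} (hf : Continuous f)
    (hiso : ∀ z ∈ S.eig, z ∉ Λ → IsIsolatedPoint (S.svs ε) z →
      ∃ w ∈ S.svs ε, (w ∈ Λ ∨ ¬ IsIsolatedPoint (S.svs ε) w) ∧ f z ≤ f w) :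
    ∃ w, IsGreatest (f '' S.svs ε) (f w) ∧ (w ∈ Λ ∨ ((ε⁻¹ : ℝ) : EReal) ≤ S.ntf w) := by
  obtain ⟨w, hw, hmax⟩ := S.exists_isMaxOn_svs hn hE hε hD hf
  by_cases h : w ∈ Λ ∨ ((ε⁻¹ : ℝ) : EReal) ≤ S.ntf w
  · exact ⟨w, hmax, h⟩
  rw [not_or] at h
  have hwE : w ∈ S.eig := ((S.mem_svs_iff hε hD).1 hw).resolve_right h.2
  have hwi : IsIsolatedPoint (S.svs ε) w := by
    by_contra h'
    exact h.2 (S.le_ntf_of_not_isolated hE hε hD hw h')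
  obtain ⟨v, hv, hv', hle⟩ := hiso w hwE h.1 hwi
  have heq : f v = f w := le_antisymm (hmax.2 ⟨v, hv, rfl⟩) hle
  exact ⟨v, by rwa [heq], hv'.imp_right fun h => S.le_ntf_of_not_isolated hE hε hD hv h⟩

/-- If the maximizer found is not selected, there is a component of the open superlevel set, and its
pole is selected. -/
theorem nonempty_selection (hn : 0 < n) (hE : IsUnit S.E) {ε : ℝ} (hε : 0 < ε)
    (hD : ‖S.D‖ < ε⁻¹) {Λ : Set ℂ} (hΛ : S.IsSelection Λ) {f : ℂ → ℝ} (hf : Continuous f)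
    (hiso : ∀ z ∈ S.eig, z ∉ Λ → IsIsolatedPoint (S.svs ε) z →
      ∃ w ∈ S.svs ε, (w ∈ Λ ∨ ¬ IsIsolatedPoint (S.svs ε) w) ∧ f z ≤ f w) : Λ.Nonempty := by
  obtain ⟨w, -, hw | hw⟩ := S.exists_max_selected_or_le_ntf hn hE hε hD hf hiso
  · exact ⟨w, hw⟩
  · obtain ⟨v, -, hv⟩ := mem_closure_iff.1 (S.mem_closure_superlevel hE hε hD hw) _ isOpen_univ
      (Set.mem_univ w)
    obtain ⟨u, -, hu⟩ := S.exists_pole_mem_component hE hD hv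
    exact ⟨u, S.mem_selection_of_ntf_eq_top hΛ hu⟩

end LTISystem

/-! ### ### The iteration cannot stall -/

/-- Near any point, two consecutive elements of a closed set with dense complement are either at
distance at least `δ` or both `δ`-close to the point. -/
theorem IsClosed.exists_consecutive_near {Y : Set ℝ} (hY : IsClosed Y)
    (hdense : ∀ a b : ℝ, a < b → ∃ y ∈ Set.Ioo a b, y ∉ Y) {y₀ δ u v : ℝ} (hδ : 0 < δ)
    (hu : u ∈ Y) (hv : v ∈ Y) (huy : u ≤ y₀ - δ) (hyv : y₀ + δ ≤ v) :
    ∃ c ∈ Y, ∃ d ∈ Y, c < d ∧ u ≤ c ∧ d ≤ v ∧ (∀ y ∈ Set.Ioo c d, y ∉ Y) ∧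
      (∃ y ∈ Set.Ioo c d, y ∈ Set.Icc (y₀ - δ) (y₀ + δ)) ∧
        (δ ≤ d - c ∨ (y₀ - δ ≤ c ∧ d ≤ y₀ + δ)) := by
  by_cases hA : ∀ y ∈ Set.Ioo (y₀ - δ) y₀, y ∉ Y
  · obtain ⟨c, hc, d, hd, h1, h2, h3, h4, h5⟩ := hY.exists_consecutive
      (hA (y₀ - δ / 2) ⟨by linarith, by linarith⟩) hu hv (by linarith) (by linarith)
    have hc' : c ≤ y₀ - δ := by
      by_contra! h; exact hA c ⟨h, by linarith⟩ hc
    have hd' : y₀ ≤ d := by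
      by_contra! h; exact hA d ⟨by linarith, h⟩ hd
    exact ⟨c, hc, d, hd, h1.trans h2, h3, h4, h5, ⟨_, ⟨h1, h2⟩, by constructor <;> linarith⟩,
      Or.inl (by linarith)⟩
  by_cases hB : ∀ y ∈ Set.Ioo y₀ (y₀ + δ), y ∉ Y
  · obtain ⟨c, hc, d, hd, h1, h2, h3, h4, h5⟩ := hY.exists_consecutive
      (hB (y₀ + δ / 2) ⟨by linarith, by linarith⟩) hu hv (by linarith) (by linarith)
    have hc' : c ≤ y₀ := by
      by_contra! h; exact hB c ⟨h, by linarith⟩ hc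
    have hd' : y₀ + δ ≤ d := by
      by_contra! h; exact hB d ⟨by linarith, h⟩ hd
    exact ⟨c, hc, d, hd, h1.trans h2, h3, h4, h5, ⟨_, ⟨h1, h2⟩, by constructor <;> linarith⟩,
      Or.inl (by linarith)⟩
  -- Now `Y` meets both halves of the neighbourhood, so the consecutive pair around a point outside
  -- `Y` is confined to it. In the two earlier cases an empty half gave a gap of length at least
  -- `δ`.
  push Not at hA hB
  obtain ⟨a, ha, haY⟩ := hA
  obtain ⟨b, hb, hbY⟩ := hB
  obtain ⟨y, hy, hyY⟩ := hdense a b (ha.2.trans hb.1)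
  obtain ⟨c, hc, d, hd, h1, h2, h3, h4, h5⟩ := hY.exists_consecutive hyY haY hbY hy.1.le hy.2.le
  have := ha.1
  have := hb.2
  have := hy.1
  have := hy.2
  exact ⟨c, hc, d, hd, h1.trans h2, by linarith, by linarith, h5,
    ⟨y, ⟨h1, h2⟩, by constructor <;> linarith⟩, Or.inr ⟨by linarith, by linarith⟩⟩

/-- The iteration cannot stall at `η'` if the superlevel set meets the line at `η'`. -/
theorem IsAlgebraicField.false_of_stall {h : ℝ → ℝ → EReal} {w w' : ℝ → ℂ}
    {P : Polynomial (Polynomial (Polynomial ℂ))} (hL : IsAlgebraicField h w w' P) {γ : ℝ}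
    (hγ : 0 < γ) {x₀ : ℝ} {w₀ : ℂ}
    (h₀ : P.eval₂ (Polynomial.evalEvalRingHom (x₀ : ℂ) ((γ ^ 2 : ℝ) : ℂ)) w₀ ≠ 0)
    {η : ℕ → ℝ} (hmono : Monotone η) {η' : ℝ} (hη : Tendsto η atTop (𝓝 η')) {y₀ : ℝ}
    (hy₀ : (γ : EReal) < h η' y₀) (K : ℝ) (Y : ℝ → Set ℝ)
    (hstep : ∃ᶠ k in atTop, IsClosed (Y (η k)) ∧
      (∀ a b : ℝ, a < b → ∃ y ∈ Set.Ioo a b, y ∉ Y (η k)) ∧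
      (∀ y, h (η k) y = γ → y ∈ Y (η k)) ∧
      (∀ δ : ℝ, 0 < δ → δ ≤ 1 → (∀ y ∈ Set.Icc (y₀ - δ) (y₀ + δ), (γ : EReal) < h (η k) y) →
        ∃ u ∈ Y (η k), ∃ v ∈ Y (η k), -K ≤ u ∧ u ≤ y₀ - δ ∧ y₀ + δ ≤ v ∧ v ≤ K) ∧
      ∀ c ∈ Y (η k), ∀ d ∈ Y (η k), c < d → (∀ y ∈ Set.Ioo c d, y ∉ Y (η k)) →
        (∀ y ∈ Set.Ioo c d, (γ : EReal) < h (η k) y) →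
          ∃ t ∈ Set.Icc (η k) (η (k + 1)), h t ((c + d) / 2) ≤ γ) : False := by
  have hbox : ∀ᶠ z : ℝ × ℝ in 𝓝 (η', y₀), (γ : EReal) < h z.1 z.2 :=
    hL.continuous_uncurry.continuousAt.eventually (lt_mem_nhds hy₀)
  obtain ⟨δ₀, hδ₀, hball⟩ := Metric.eventually_nhds_iff_ball.1 hbox
  -- The cap 1 allows the bound `K` to be fixed before `δ`.
  set δ := min (δ₀ / 2) 1 with hδdef
  have hδ : 0 < δ := by positivity
  have hδ1 : δ ≤ 1 := min_le_right _ _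
  have hδ2 : δ < δ₀ := (min_le_left _ _).trans_lt (by linarith)
  have hbox' : ∀ x ∈ Set.Icc (η' - δ) η', ∀ y ∈ Set.Icc (y₀ - δ) (y₀ + δ),
      (γ : EReal) < h x y := by
    intro x hx y hy
    refine hball (x, y) ?_
    rw [Metric.mem_ball, Prod.dist_eq, max_lt_iff, Real.dist_eq, Real.dist_eq, abs_lt, abs_lt]
    refine ⟨⟨?_, ?_⟩, ?_, ?_⟩ <;> linarith [hx.1, hx.2, hy.1, hy.2]
  have hle : ∀ k, η k ≤ η' := hmono.ge_of_tendsto hη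
  have hnear : ∀ᶠ k in atTop, η' - δ < η k := hη.eventually (lt_mem_nhds (by linarith))
  have key : ∃ᶠ k in atTop, ∃ c d, c ∈ Set.Icc (-K) K ∧ d ∈ Set.Icc (-K) K ∧ δ ≤ d - c ∧
      (∀ y ∈ Set.Ioo c d, (γ : EReal) < h (η k) y) ∧
        ∃ t, η k < t ∧ t ≤ η (k + 1) ∧ h t ((c + d) / 2) ≤ γ := by
    refine (hstep.and_eventually hnear).mono ?_
    rintro k ⟨⟨hcl, hdense, hmem, hends, hmid⟩, hk⟩
    have hline : ∀ y ∈ Set.Icc (y₀ - δ) (y₀ + δ), (γ : EReal) < h (η k) y :=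
      hbox' (η k) ⟨hk.le, hle k⟩
    obtain ⟨u, hu, v, hv, hKu, huy, hyv, hvK⟩ := hends δ hδ hδ1 hline
    obtain ⟨c, hc, d, hd, hcd, huc, hdv, hno, ⟨y, hy, hyI⟩, hgap⟩ :=
      hcl.exists_consecutive_near hdense hδ hu hv huy hyv
    have hgt : ∀ y ∈ Set.Ioo c d, (γ : EReal) < h (η k) y :=
      lt_on_of_ne isPreconnected_Ioo (hL.continuous_right (η k)).continuousOn
        (fun y hy e => hno y hy (hmem y e)) hy (hline y hyI)
    obtain ⟨t, ht, htle⟩ := hmid c hc d hd hcd hno hgt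
    have hmidI : (c + d) / 2 ∈ Set.Ioo c d := ⟨by linarith, by linarith⟩
    have htgt : η k < t := by
      refine lt_of_le_of_ne ht.1 fun e => ?_
      rw [← e] at htle
      exact htle.not_gt (hgt _ hmidI)
    rcases hgap with hgap | ⟨hc1, hd1⟩
    · exact ⟨c, d, ⟨by linarith, by linarith⟩, ⟨by linarith, by linarith⟩, hgap, hgt, t, htgt,
        ht.2, htle⟩
    -- A gap inside the box cannot be blocked: its midpoint exceeds the level all the way to `η'`.
    · exact absurd (hbox' t ⟨by linarith, ht.2.trans (hle _)⟩ ((c + d) / 2)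
        ⟨by linarith [hmidI.1], by linarith [hmidI.2]⟩) htle.not_gt
  have hlt : ∀ k, η k < η' := by
    intro k
    obtain ⟨j, hj, c, d, -, -, -, -, t, ht1, ht2, -⟩ := frequently_atTop.1 key k
    exact (hmono hj).trans_lt (ht1.trans_le (ht2.trans (hle _)))
  refine hL.not_frequently_blocked hγ h₀ hη hlt hδ (K := K) (key.mono ?_)
  rintro k ⟨c, d, hc, hd, hcd, hgt, t, ht1, ht2, ht3⟩
  exact ⟨c, d, hc, hd, hcd, hgt, t, ht1.le, ht2.trans_lt (hlt _), ht3⟩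

/-- On an interval whose interior exceeds the level, the closed interval reaches the level. -/
theorem le_on_Icc_of_lt_on_Ioo {u : ℝ → EReal} (hu : Continuous u) {γ : EReal} {c d : ℝ}
    (hcd : c < d) (h : ∀ y ∈ Set.Ioo c d, γ < u y) : ∀ y ∈ Set.Icc c d, γ ≤ u y := by
  intro y hy
  rw [← closure_Ioo hcd.ne] at hy
  exact closure_minimal (fun y hy => (h y hy).le) (isClosed_Ici.preimage hu) hy

/-- A left endpoint determines the next element, so there are no more midpoints than left endpoints.
-/
theorem subsingleton_crossSection_midpoints (Y : Set ℝ) (P : ℝ → Prop) (a : ℝ) :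
    {ψ | ∃ b, IsCrossSection Y P a b ∧ ψ = (a + b) / 2}.Subsingleton := by
  rintro _ ⟨b, hb, rfl⟩ _ ⟨b', hb', rfl⟩
  have : b = b' := by
    rcases lt_trichotomy b b' with h | h | h
    · exact absurd hb.2.1 (hb'.2.2.2.1 b ⟨hb.2.2.1, h⟩)
    · exact h
    · exact absurd hb'.2.1 (hb.2.2.2.1 b' ⟨hb'.2.2.1, h⟩)
  rw [this]

namespace LTISystem

variable {n m p : ℕ} (S : LTISystem n m p)

/-! ### The abscissa -/

theorem isAlgebraicField_vert (hE : IsUnit S.E) :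
    IsAlgebraicField (fun x y => S.ntf (x + y * Complex.I)) (fun y => y * Complex.I)
      (fun _ => Complex.I) S.vertPoly where
  continuous_uncurry := (S.continuous_ntf hE).comp
    (f := fun q : ℝ × ℝ => ((q.1 : ℂ) + q.2 * Complex.I)) (by fun_prop)
  hasDerivAt y := by simpa using (Complex.ofRealCLM.hasDerivAt (x := y)).mul_const Complex.I
  continuous_deriv := continuous_const
  deriv_ne_zero _ := Complex.I_ne_zero
  eval_eq_zero x y σ hσ h := by rw [S.eval₂_vertPoly_I]; exact S.svDet_of_ntf_eq hE hσ h

theorem horizFun_pos_iff {ε y x : ℝ} :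
    0 < S.horizFun ε y x ↔ ((ε⁻¹ : ℝ) : EReal) < S.ntf (x + y * Complex.I) :=
  EReal.zero_lt_sub_coe_iff _ _

theorem horizFun_eq_zero_iff {ε y x : ℝ} :
    S.horizFun ε y x = 0 ↔ S.ntf (x + y * Complex.I) = ((ε⁻¹ : ℝ) : EReal) :=
  EReal.sub_coe_eq_zero_iff _ _

theorem exists_root_horizFun (hE : IsUnit S.E) {ε : ℝ} (hD : ‖S.D‖ < ε⁻¹) (ψ x : ℝ)
    (h : 0 < S.horizFun ε ψ x) : ∃ r, IsRootToTheRight (S.horizFun ε ψ) x r := by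
  obtain ⟨M, hM⟩ := S.exists_forall_ntf_lt hE hD
  refine exists_isRootToTheRight (M := M) ((S.isAlgebraicField_vert hE).continuous_left ψ)
    (S.horizFun_pos_iff.1 h) fun x hx => (hM _ ?_).2
  refine hx.trans ((le_abs_self x).trans ?_)
  simpa using Complex.abs_re_le_norm (x + ψ * Complex.I)

theorem finite_vertMidpoints (hE : IsUnit S.E) {ε : ℝ} (hε : 0 < ε) (hD : ‖S.D‖ < ε⁻¹) (x : ℝ) :
    (S.vertMidpoints ε x).Finite := by
  refine ((S.finite_vertEigs hE hε hD x).biUnion fun a _ => (subsingleton_crossSection_midpoints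
    (S.vertEigs ε x) (fun y => (x + y * Complex.I : ℂ) ∈ S.svs ε) a).finite).subset ?_
  rintro ψ ⟨a, b, hab, rfl⟩
  exact Set.mem_biUnion hab.1 ⟨b, hab, rfl⟩

theorem isGreatest_abscissa (hn : 0 < n) (hE : IsUnit S.E) {ε : ℝ} (hε : 0 < ε)
    (hD : ‖S.D‖ < ε⁻¹) : IsGreatest (Complex.re '' S.svs ε) (S.abscissa ε) := by
  obtain ⟨w, -, hw⟩ := S.exists_isMaxOn_svs hn hE hε hD Complex.continuous_re
  rwa [abscissa, hw.csSup_eq]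

theorem le_abscissa_of_fastSearchSet (hn : 0 < n) (hE : IsUnit S.E) {ε : ℝ} (hε : 0 < ε)
    (hD : ‖S.D‖ < ε⁻¹) {x x' : ℝ} {Ψ : Set ℝ} (h : FastSearchSet (S.horizFun ε) x Ψ x')
    (hx : x ≤ S.abscissa ε) : x' ≤ S.abscissa ε := by
  rcases h.spec.2.1 with rfl | ⟨ψ, -, h0⟩
  · exact hx
  · refine (S.isGreatest_abscissa hn hE hε hD).2 ⟨x' + ψ * Complex.I, ?_, by simp⟩
    exact (S.mem_svs_iff hε hD).2 (Or.inr (S.horizFun_eq_zero_iff.1 h0).ge)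

theorem tendsto_of_isAbsRun (hn : 0 < n) (hE : IsUnit S.E) {ε : ℝ} (hε : 0 < ε)
    (hD : ‖S.D‖ < ε⁻¹) {Λ : Set ℂ} (hΛ : S.IsSelection Λ)
    (hiso : ∀ z ∈ S.eig, z ∉ Λ → IsIsolatedPoint (S.svs ε) z →
      ∃ w ∈ S.svs ε, (w ∈ Λ ∨ ¬ IsIsolatedPoint (S.svs ε) w) ∧ z.re ≤ w.re)
    {η : ℕ → ℝ} (hη : S.IsAbsRun ε Λ η) : Tendsto η atTop (𝓝 (S.abscissa ε)) := by
  have hgr := S.isGreatest_abscissa hn hE hε hD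
  obtain ⟨⟨z₀, hz₀, hz₀max, hinit⟩, hsteps⟩ := hη
  have hmono : Monotone η := monotone_nat_of_le_succ fun k => by
    by_cases h : η k < S.abscissa ε
    · exact ((hsteps k).1 h).spec.1
    · exact ((hsteps k).2 h).ge
  have hle : ∀ k, η k ≤ S.abscissa ε := by
    intro k
    induction k with
    | zero =>
      exact S.le_abscissa_of_fastSearchSet hn hE hε hD hinit
        (hgr.2 ⟨z₀, S.eig_subset_svs hε (hΛ.1 hz₀), rfl⟩)
    | succ k ih =>
      by_cases h : η k < S.abscissa ε
      · exact S.le_abscissa_of_fastSearchSet hn hE hε hD ((hsteps k).1 h) ih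
      · rw [(hsteps k).2 h]; exact ih
  have hlim := tendsto_atTop_ciSup hmono ⟨_, by rintro _ ⟨k, rfl⟩; exact hle k⟩
  set η' := ⨆ k, η k with hη'
  have hη'le : η' ≤ S.abscissa ε := le_of_tendsto' hlim hle
  rcases hη'le.eq_or_lt with he | hlt
  · rwa [← he]
  exfalso
  have hk' : ∀ k, η k ≤ η' := hmono.ge_of_tendsto hlim
  have hklt : ∀ k, η k < S.abscissa ε := fun k => (hk' k).trans_lt hlt
  have hΛle : ∀ w ∈ Λ, w.re ≤ η' := fun w hw =>
    (hz₀max w hw).trans (hinit.spec.1.trans (hk' 0))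
  obtain ⟨w, hwgr, hw⟩ := S.exists_max_selected_or_le_ntf hn hE hε hD Complex.continuous_re hiso
  have hwre : w.re = S.abscissa ε := hwgr.unique hgr
  rcases hw with hw | hw
  · exact (hΛle w hw).not_gt (hwre ▸ hlt)
  obtain ⟨z, hz, hzre⟩ := S.exists_superlevel_of_between hE hε hD hΛ Complex.continuous_re hΛle hw
    (hwre ▸ hlt)
  obtain ⟨M, hM⟩ := S.exists_forall_ntf_lt hE hD
  have hfar : ∀ x y : ℝ, M ≤ |y| → (x + y * Complex.I : ℂ) ∉ S.eig ∧
      S.ntf (x + y * Complex.I) < ((ε⁻¹ : ℝ) : EReal) := fun x y hy =>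
    hM _ (hy.trans (by simpa using Complex.abs_im_le_norm (x + y * Complex.I)))
  have hL := S.isAlgebraicField_vert hE
  -- The point `iM` far up the imaginary axis certifies that the polynomial is nonzero at the level
  -- `ε⁻¹`.
  refine hL.false_of_stall (inv_pos.2 hε) (x₀ := 0) (w₀ := (M : ℝ) * Complex.I) ?_ hmono hlim
    (y₀ := z.im) ?_ (|M| + |z.im| + 1) (S.vertEigs ε) (Frequently.of_forall fun k => ?_)
  · rw [S.eval₂_vertPoly_I]
    obtain ⟨h1, h2⟩ := hfar 0 M (le_abs_self M)
    exact S.svDet_ne_zero h1 h2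
  · rw [← hzre]; simpa [Complex.re_add_im] using hz
  have hfin := S.finite_vertEigs hE hε hD (η k)
  refine ⟨hfin.isClosed, fun a b hab => ?_, fun y hy => S.mem_vertEigs_of_ntf_eq hE hε hD hy,
    fun δ hδ hδ1 hδI => ?_, fun c hc d hd hcd hno hgt => ?_⟩
  · obtain ⟨y, hy, hy'⟩ := (Set.Ioo_infinite hab).exists_notMem_finite hfin
    exact ⟨y, hy, hy'⟩
  · set K := |M| + |z.im| + 1 with hK
    have hMK : M ≤ |K| := by
      rw [abs_of_nonneg (by positivity)]
      linarith [le_abs_self M, abs_nonneg z.im]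
    have habs := abs_le.1 (le_refl |z.im|)
    have hMnn := abs_nonneg M
    have hcont := hL.continuous_right (η k)
    -- Between the edges of the neighbourhood, where the level is exceeded, and `±K`, where the
    -- value is below it, the level is attained on either side.
    obtain ⟨u, hu, huγ⟩ := intermediate_value_Icc (show -K ≤ z.im - δ by linarith)
      hcont.continuousOn ⟨(hfar (η k) (-K) (by rwa [abs_neg])).2.le,
        (hδI (z.im - δ) ⟨le_rfl, by linarith⟩).le⟩
    obtain ⟨v, hv, hvγ⟩ := intermediate_value_Icc' (show z.im + δ ≤ K by linarith)
      hcont.continuousOn ⟨(hfar (η k) K hMK).2.le,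
        (hδI (z.im + δ) ⟨by linarith, le_rfl⟩).le⟩
    exact ⟨u, S.mem_vertEigs_of_ntf_eq hE hε hD huγ, v, S.mem_vertEigs_of_ntf_eq hE hε hD hvγ,
      hu.1, hu.2, hv.1, hv.2⟩
  · have hmem : (c + d) / 2 ∈ S.vertMidpoints ε (η k) := by
      refine ⟨c, d, ⟨hc, hd, hcd, hno, fun y hy => (S.mem_svs_iff hε hD).2 (Or.inr ?_)⟩, rfl⟩
      exact le_on_Icc_of_lt_on_Ioo (hL.continuous_right (η k)) hcd hgt y hy
    obtain ⟨t, ht, ht'⟩ := ((hsteps k).1 (hklt k)).spec.2.2 _ hmem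
    exact ⟨t, ht, not_lt.1 fun h => ht' (S.horizFun_pos_iff.2 h)⟩

end LTISystem

/-! ### ### Random angles and polar coordinates -/

/-- Independent uniform angles visit every interval infinitely often. -/
theorem ae_frequently_mem_Ioo_of_isUniform {Ω : Type*} [MeasurableSpace Ω] {P : Measure Ω}
    [IsProbabilityMeasure P] {φ : ℕ → Ω → ℝ} (hφ : ∀ k, Measurable (φ k))
    (hunif : ∀ k, pdf.IsUniform (φ k) (Set.Ico 0 (2 * Real.pi)) P) (hind : iIndepFun φ P)
    {a b : ℝ} (ha : 0 ≤ a) (hab : a < b) (hb : b ≤ 2 * Real.pi) :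
    ∀ᵐ ω ∂P, ∃ᶠ k in atTop, φ k ω ∈ Set.Ioo a b := by
  set s : ℕ → Set Ω := fun k => φ k ⁻¹' Set.Ioo a b with hs
  have hsm : ∀ k, MeasurableSet (s k) := fun k => hφ k measurableSet_Ioo
  have hsi : iIndepSet s P := (iIndepSet_iff_meas_biInter hsm).2 fun t =>
    hind.measure_inter_preimage_eq_mul t fun _ _ => measurableSet_Ioo
  have hsub : Set.Ico 0 (2 * Real.pi) ∩ Set.Ioo a b = Set.Ioo a b :=
    Set.inter_eq_right.2 fun x hx => ⟨ha.trans hx.1.le, hx.2.trans_le hb⟩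
  have hval : ∀ k, P (s k) =
      (volume (Set.Ico 0 (2 * Real.pi)))⁻¹ * volume (Set.Ioo a b) := by
    intro k
    have h1 := hunif k
    rw [pdf.IsUniform] at h1
    rw [hs, ← Measure.map_apply (hφ k) measurableSet_Ioo, h1, cond_apply measurableSet_Ico, hsub]
  -- All the probabilities are the same positive number, so the second Borel–Cantelli lemma applies.
  have hsum : ∑' k, P (s k) = ⊤ := by
    simp only [hval]
    refine ENNReal.tsum_const_eq_top_of_ne_zero (mul_ne_zero (ENNReal.inv_ne_zero.2 ?_) ?_)
    · rw [Real.volume_Ico]; exact ENNReal.ofReal_ne_top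
    · simp [Real.volume_Ioo, hab]
  have hlim := measure_limsup_eq_one hsm hsi hsum
  have hmeas : MeasurableSet (limsup s atTop) := MeasurableSet.measurableSet_limsup hsm
  have := (prob_compl_eq_zero_iff hmeas).2 hlim
  filter_upwards [compl_mem_ae_iff.2 this] with ω hω
  rw [compl_compl] at hω
  exact mem_limsup_iff_frequently_mem.1 hω

theorem continuous_polarPt : Continuous fun q : ℝ × ℝ => polarPt q.1 q.2 := by
  unfold polarPt; fun_prop

theorem norm_polarPt (r θ : ℝ) : ‖polarPt r θ‖ = |r| := by
  rw [polarPt, norm_mul, Complex.norm_exp_ofReal_mul_I, mul_one, Complex.norm_real, Real.norm_eq_abs]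

theorem exp_ofReal_add_zsmul (θ : ℝ) (j : ℤ) :
    Complex.exp (((θ + j • (2 * Real.pi) : ℝ) : ℂ) * Complex.I) =
      Complex.exp (θ * Complex.I) := by
  rw [Complex.exp_eq_exp_iff_exists_int]
  exact ⟨j, by push_cast; simp; ring⟩

theorem polarPt_add_zsmul (r θ : ℝ) (j : ℤ) : polarPt r (θ + j • (2 * Real.pi)) = polarPt r θ := by
  rw [polarPt, exp_ofReal_add_zsmul, polarPt]

namespace LTISystem

variable {n m p : ℕ} (S : LTISystem n m p)

/-! ### The radius -/

theorem isAlgebraicField_circ (hE : IsUnit S.E) :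
    IsAlgebraicField (fun r θ => S.ntf (polarPt r θ)) (fun θ => Complex.exp (θ * Complex.I))
      (fun θ => Complex.exp (θ * Complex.I) * Complex.I) S.circPoly where
  continuous_uncurry := (S.continuous_ntf hE).comp
    (f := fun q : ℝ × ℝ => polarPt q.1 q.2) continuous_polarPt
  hasDerivAt y := by
    simpa using ((Complex.ofRealCLM.hasDerivAt (x := y)).mul_const Complex.I).cexp
  continuous_deriv := by fun_prop
  deriv_ne_zero _ := mul_ne_zero (Complex.exp_ne_zero _) Complex.I_ne_zero
  eval_eq_zero x y σ hσ h := by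
    rw [S.eval₂_circPoly_exp, S.svDet_of_ntf_eq hE hσ h, mul_zero]

theorem radFun_pos_iff {ε θ r : ℝ} :
    0 < S.radFun ε θ r ↔ ((ε⁻¹ : ℝ) : EReal) < S.ntf (polarPt r θ) :=
  EReal.zero_lt_sub_coe_iff _ _

theorem radFun_eq_zero_iff {ε θ r : ℝ} :
    S.radFun ε θ r = 0 ↔ S.ntf (polarPt r θ) = ((ε⁻¹ : ℝ) : EReal) :=
  EReal.sub_coe_eq_zero_iff _ _

theorem exists_root_radFun (hE : IsUnit S.E) {ε : ℝ} (hD : ‖S.D‖ < ε⁻¹) (ψ x : ℝ)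
    (h : 0 < S.radFun ε ψ x) : ∃ r, IsRootToTheRight (S.radFun ε ψ) x r := by
  obtain ⟨M, hM⟩ := S.exists_forall_ntf_lt hE hD
  refine exists_isRootToTheRight (M := M) ((S.isAlgebraicField_circ hE).continuous_left ψ)
    (S.radFun_pos_iff.1 h) fun x hx => (hM _ ?_).2
  rw [norm_polarPt]
  exact hx.trans (le_abs_self x)

/-- The polynomial in `exp (i θ)` whose zeros are the angles found at radius `r`. -/
noncomputable def circLinePoly (ε r : ℝ) : Polynomial ℂ :=
  S.circPoly.map (Polynomial.evalEvalRingHom (r : ℂ) ((ε⁻¹ ^ 2 : ℝ) : ℂ))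

theorem mem_circEigs_iff_eval {ε r θ : ℝ} (hε : 0 < ε) (hD : ‖S.D‖ < ε⁻¹) :
    θ ∈ S.circEigs ε r ↔ (S.circLinePoly ε r).eval (Complex.exp (θ * Complex.I)) = 0 := by
  rw [S.mem_circEigs hε hD, circLinePoly, Polynomial.eval_map, S.eval₂_circPoly_exp, mul_eq_zero,
    or_iff_right (pow_ne_zero _ (Complex.exp_ne_zero _))]

theorem isClosed_circEigs {ε r : ℝ} (hε : 0 < ε) (hD : ‖S.D‖ < ε⁻¹) :
    IsClosed (S.circEigs ε r) := by
  have : S.circEigs ε r =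
      (fun θ : ℝ => (S.circLinePoly ε r).eval (Complex.exp (θ * Complex.I))) ⁻¹' {0} := by
    ext θ; exact S.mem_circEigs_iff_eval hε hD
  rw [this]
  exact isClosed_singleton.preimage ((Polynomial.continuous _).comp (by fun_prop))

theorem add_zsmul_mem_circEigs {ε r θ : ℝ} (j : ℤ) :
    θ + j • (2 * Real.pi) ∈ S.circEigs ε r ↔ θ ∈ S.circEigs ε r := by
  rw [circEigs, Set.mem_ofPred_eq, exp_ofReal_add_zsmul, Set.mem_ofPred_eq]

theorem circLinePoly_ne_zero {ε r θ : ℝ} (hε : 0 < ε) (hD : ‖S.D‖ < ε⁻¹)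
    (h : θ ∉ S.circEigs ε r) : S.circLinePoly ε r ≠ 0 := fun h0 =>
  h ((S.mem_circEigs_iff_eval hε hD).2 (by rw [h0, Polynomial.eval_zero]))

theorem exists_mem_Ioo_notMem_circEigs {ε r : ℝ} (hε : 0 < ε) (hD : ‖S.D‖ < ε⁻¹)
    (h : S.circLinePoly ε r ≠ 0) {a b : ℝ} (hab : a < b) :
    ∃ y ∈ Set.Ioo a b, y ∉ S.circEigs ε r := by
  have hmid : (a + b) / 2 ∈ Set.Ioo a b := ⟨by linarith, by linarith⟩
  have hder : HasDerivAt (fun θ : ℝ => Complex.exp (θ * Complex.I))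
      (Complex.exp (((a + b) / 2 : ℝ) * Complex.I) * Complex.I) ((a + b) / 2) := by
    simpa using ((Complex.ofRealCLM.hasDerivAt (x := (a + b) / 2)).mul_const Complex.I).cexp
  have hev : ∀ᶠ y in 𝓝[≠] ((a + b) / 2), ∀ z ∈ {z | (S.circLinePoly ε r).IsRoot z},
      Complex.exp ((y : ℝ) * Complex.I) ≠ z :=
    (Filter.eventually_all_finite (Polynomial.finite_setOfPred_isRoot h)).2 fun z _ =>
      hder.eventually_ne (mul_ne_zero (Complex.exp_ne_zero _) Complex.I_ne_zero)
  obtain ⟨y, hy, hyI⟩ := (hev.and (nhdsWithin_le_nhds (Ioo_mem_nhds hmid.1 hmid.2))).exists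
  exact ⟨y, hyI, fun hmem => hy _ ((S.mem_circEigs_iff_eval hε hD).1 hmem) rfl⟩

theorem finite_circMidpoints {ε : ℝ} (hε : 0 < ε) (hD : ‖S.D‖ < ε⁻¹) (r : ℝ) :
    (S.circMidpoints ε r).Finite := by
  by_cases h0 : S.circLinePoly ε r = 0
  -- For a singular pencil every angle is an eigenvalue angle, and there are no gaps.
  · convert Set.finite_empty
    refine Set.eq_empty_of_forall_notMem ?_
    rintro ψ ⟨a, -, b, hab, -⟩
    refine S.circLinePoly_ne_zero hε hD (hab.2.2.2.1 ((a + b) / 2) ?_) h0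
    constructor <;> linarith [hab.2.2.1]
  have hfin : (S.circEigs ε r ∩ Set.Ico 0 (2 * Real.pi)).Finite := by
    refine Set.Finite.of_injOn (f := fun θ : ℝ => Complex.exp (θ * Complex.I))
      (t := {z | (S.circLinePoly ε r).IsRoot z})
      (fun θ hθ => (S.mem_circEigs_iff_eval hε hD).1 hθ.1) ?_
      (Polynomial.finite_setOfPred_isRoot h0)
    intro x hx y hy hxy
    obtain ⟨j, hj⟩ := Complex.exp_eq_exp_iff_exists_int.1 hxy
    have hj' : (x : ℂ) = ((y + j * (2 * Real.pi) : ℝ) : ℂ) := by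
      apply mul_right_cancel₀ Complex.I_ne_zero
      rw [hj]; push_cast; ring
    have hj'' : x = y + j * (2 * Real.pi) := by exact_mod_cast hj'
    have hpi := Real.pi_pos
    have h1 : (j : ℝ) < 1 := by
      by_contra! h
      nlinarith [hx.2.2, hy.2.1]
    have h2 : (-1 : ℝ) < j := by
      by_contra! h
      nlinarith [hx.2.1, hy.2.2]
    have : j = 0 := by
      have h1' : j < 1 := by exact_mod_cast h1
      have h2' : -1 < j := by exact_mod_cast h2
      omega
    rw [hj'', this]; simp
  refine (hfin.biUnion fun a _ => (subsingleton_crossSection_midpoints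
    (S.circEigs ε r) (fun θ => polarPt r θ ∈ S.svs ε) a).finite).subset ?_
  rintro ψ ⟨a, ha, b, hab, rfl⟩
  exact Set.mem_biUnion ⟨hab.1, ha⟩ ⟨b, hab, rfl⟩

theorem isGreatest_radius (hn : 0 < n) (hE : IsUnit S.E) {ε : ℝ} (hε : 0 < ε)
    (hD : ‖S.D‖ < ε⁻¹) : IsGreatest ((fun z : ℂ => ‖z‖) '' S.svs ε) (S.radius ε) := by
  obtain ⟨w, -, hw⟩ := S.exists_isMaxOn_svs hn hE hε hD (f := fun z : ℂ => ‖z‖) continuous_norm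
  rwa [radius, hw.csSup_eq]

theorem le_radius_of_fastSearchSet (hn : 0 < n) (hE : IsUnit S.E) {ε : ℝ} (hε : 0 < ε)
    (hD : ‖S.D‖ < ε⁻¹) {x x' : ℝ} {Ψ : Set ℝ} (h : FastSearchSet (S.radFun ε) x Ψ x')
    (hx : x ≤ S.radius ε) : x' ≤ S.radius ε := by
  rcases h.spec.2.1 with rfl | ⟨ψ, -, h0⟩
  · exact hx
  · refine (le_abs_self x').trans ?_
    rw [← norm_polarPt x' ψ]
    refine (S.isGreatest_radius hn hE hε hD).2 ⟨polarPt x' ψ, ?_, rfl⟩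
    exact (S.mem_svs_iff hε hD).2 (Or.inr (S.radFun_eq_zero_iff.1 h0).ge)

/-- The radius algorithm converges if the angles drawn visit every interval infinitely often. -/
theorem tendsto_of_isRadRun (hn : 0 < n) (hE : IsUnit S.E) {ε : ℝ} (hε : 0 < ε)
    (hD : ‖S.D‖ < ε⁻¹) {Λ : Set ℂ} (hΛ : S.IsSelection Λ)
    (hiso : ∀ z ∈ S.eig, z ∉ Λ → IsIsolatedPoint (S.svs ε) z →
      ∃ w ∈ S.svs ε, (w ∈ Λ ∨ ¬ IsIsolatedPoint (S.svs ε) w) ∧ ‖z‖ ≤ ‖w‖)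
    {q : ℕ} {φ : ℕ → Fin q → ℝ} {j₀ : Fin q}
    (hφ : ∀ a b : ℝ, 0 ≤ a → a < b → b ≤ 2 * Real.pi → ∃ᶠ k in atTop, φ k j₀ ∈ Set.Ioo a b)
    {η : ℕ → ℝ} (hη : S.IsRadRun ε Λ φ η) : Tendsto η atTop (𝓝 (S.radius ε)) := by
  have hgr := S.isGreatest_radius hn hE hε hD
  obtain ⟨⟨z₀, hz₀, hz₀max, hinit⟩, hsteps⟩ := hη
  have hmono : Monotone η := monotone_nat_of_le_succ fun k => by
    by_cases h : η k < S.radius ε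
    · exact ((hsteps k).1 h).spec.1
    · exact ((hsteps k).2 h).ge
  have hle : ∀ k, η k ≤ S.radius ε := by
    intro k
    induction k with
    | zero =>
      exact S.le_radius_of_fastSearchSet hn hE hε hD hinit
        (hgr.2 ⟨z₀, S.eig_subset_svs hε (hΛ.1 hz₀), rfl⟩)
    | succ k ih =>
      by_cases h : η k < S.radius ε
      · exact S.le_radius_of_fastSearchSet hn hE hε hD ((hsteps k).1 h) ih
      · rw [(hsteps k).2 h]; exact ih
  have hlim := tendsto_atTop_ciSup hmono ⟨_, by rintro _ ⟨k, rfl⟩; exact hle k⟩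
  set η' := ⨆ k, η k with hη'
  have hη'le : η' ≤ S.radius ε := le_of_tendsto' hlim hle
  rcases hη'le.eq_or_lt with he | hlt
  · rwa [← he]
  exfalso
  have hk' : ∀ k, η k ≤ η' := hmono.ge_of_tendsto hlim
  have hklt : ∀ k, η k < S.radius ε := fun k => (hk' k).trans_lt hlt
  have hΛle : ∀ w ∈ Λ, ‖w‖ ≤ η' := fun w hw =>
    (hz₀max w hw).trans (hinit.spec.1.trans (hk' 0))
  obtain ⟨w, hwgr, hw⟩ := S.exists_max_selected_or_le_ntf hn hE hε hD
    (f := fun z : ℂ => ‖z‖) continuous_norm hiso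
  have hwn : ‖w‖ = S.radius ε := hwgr.unique hgr
  rcases hw with hw | hw
  · exact (hΛle w hw).not_gt (hwn ▸ hlt)
  obtain ⟨z, hz, hzn⟩ := S.exists_superlevel_of_between hE hε hD hΛ
    (f := fun z : ℂ => ‖z‖) continuous_norm hΛle hw (show η' < ‖w‖ from hwn ▸ hlt)
  have hpi := Real.two_pi_pos
  obtain ⟨j, hj, -⟩ := existsUnique_add_zsmul_mem_Ico hpi z.arg 0
  set θ₀ := z.arg + j • (2 * Real.pi) with hθ₀
  rw [zero_add] at hj
  have hzθ : polarPt η' θ₀ = z := by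
    rw [hθ₀, polarPt_add_zsmul, polarPt, ← hzn]
    exact Complex.norm_mul_exp_arg_mul_I z
  have hL := S.isAlgebraicField_circ hE
  have hθ₀gt : ((ε⁻¹ : ℝ) : EReal) < S.ntf (polarPt η' θ₀) := by rwa [hzθ]
  -- If arcs are found infinitely often, the stalling argument applies at those steps; each such arc
  -- also shows the pencil to be regular.
  by_cases hfreq : ∃ᶠ k in atTop, (S.circMidpoints ε (η k)).Nonempty
  · obtain ⟨M, hM⟩ := S.exists_forall_ntf_lt hE hD
    refine hL.false_of_stall (inv_pos.2 hε) (x₀ := M)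
      (w₀ := Complex.exp ((0 : ℝ) * Complex.I)) ?_ hmono hlim (y₀ := θ₀) hθ₀gt
      (|θ₀| + 1 + 2 * Real.pi) (S.circEigs ε) (hfreq.mono ?_)
    · rw [S.eval₂_circPoly_exp]
      obtain ⟨h1, h2⟩ := hM (polarPt M 0) (by rw [norm_polarPt]; exact le_abs_self M)
      exact mul_ne_zero (pow_ne_zero _ (Complex.exp_ne_zero _)) (S.svDet_ne_zero h1 h2)
    rintro k ⟨ψ, a, -, b, hab, -⟩
    have hne : S.circLinePoly ε (η k) ≠ 0 :=
      S.circLinePoly_ne_zero hε hD (hab.2.2.2.1 ((a + b) / 2)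
        (by constructor <;> linarith [hab.2.2.1]))
    refine ⟨S.isClosed_circEigs hε hD, fun _ _ h => S.exists_mem_Ioo_notMem_circEigs hε hD hne h,
      fun y hy => (S.mem_circEigs hε hD).2 (S.svDet_of_ntf_eq hE (inv_pos.2 hε) hy),
      fun δ hδ hδ1 _ => ?_, fun c hc d hd hcd hno hgt => ?_⟩
    -- By periodicity, translates of the single eigenvalue angle `a` lie on both sides of `θ₀`
    -- within `1 + 2π`.
    · obtain ⟨i, hi, -⟩ := existsUnique_add_zsmul_mem_Ico hpi a (θ₀ - 1 - 2 * Real.pi)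
      obtain ⟨i', hi', -⟩ := existsUnique_add_zsmul_mem_Ico hpi a (θ₀ + 1)
      have habs := abs_le.1 (le_refl |θ₀|)
      exact ⟨_, (S.add_zsmul_mem_circEigs i).2 hab.1, _, (S.add_zsmul_mem_circEigs i').2 hab.1,
        by linarith [hi.1], by linarith [hi.2], by linarith [hi'.1], by linarith [hi'.2]⟩
    -- The gap is translated so that its left endpoint falls in `[0, 2π)`, as the search requires.
    · obtain ⟨i, hi, -⟩ := existsUnique_add_zsmul_mem_Ico hpi c 0
      rw [zero_add] at hi
      have hmem : (c + d) / 2 + i • (2 * Real.pi) ∈ S.circMidpoints ε (η k) := by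
        refine ⟨_, hi, d + i • (2 * Real.pi), ⟨(S.add_zsmul_mem_circEigs i).2 hc,
          (S.add_zsmul_mem_circEigs i).2 hd, by linarith, fun y hy => ?_, fun y hy => ?_⟩, by ring⟩
        · have := hno (y + (-i) • (2 * Real.pi)) ⟨by rw [neg_smul]; linarith [hy.1],
            by rw [neg_smul]; linarith [hy.2]⟩
          rwa [S.add_zsmul_mem_circEigs] at this
        · beta_reduce
          rw [← polarPt_add_zsmul _ y (-i)]
          refine (S.mem_svs_iff hε hD).2 (Or.inr ?_)
          exact le_on_Icc_of_lt_on_Ioo (hL.continuous_right (η k)) hcd hgt _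
            ⟨by rw [neg_smul]; linarith [hy.1], by rw [neg_smul]; linarith [hy.2]⟩
      have hdir : S.radDirections ε (φ (k + 1)) (η k) = S.circMidpoints ε (η k) := by
        rw [radDirections, if_neg (Set.Nonempty.ne_empty ⟨_, hmem⟩)]
      obtain ⟨t, ht, ht'⟩ := ((hsteps k).1 (hklt k)).spec.2.2 _ (hdir ▸ hmem)
      refine ⟨t, ht, not_lt.1 fun h => ht' (S.radFun_pos_iff.2 ?_)⟩
      rwa [polarPt_add_zsmul]
  -- From some step on only random angles are used. One close to `θ₀` stays above the level up to
  -- `η'`, which contradicts the end of its search before `η'`.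
  · rw [not_frequently] at hfreq
    have hbox : ∀ᶠ z : ℝ × ℝ in 𝓝 (η', θ₀), ((ε⁻¹ : ℝ) : EReal) < S.ntf (polarPt z.1 z.2) :=
      hL.continuous_uncurry.continuousAt.eventually (lt_mem_nhds hθ₀gt)
    obtain ⟨δ, hδ, hball⟩ := Metric.eventually_nhds_iff_ball.1 hbox
    have hnear : ∀ᶠ k in atTop, η' - δ < η k := hlim.eventually (lt_mem_nhds (by linarith))
    have hvisit : ∃ᶠ k in atTop, φ (k + 1) j₀ ∈ Set.Ioo θ₀ (min (θ₀ + δ) (2 * Real.pi)) := by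
      have h1 := hφ θ₀ (min (θ₀ + δ) (2 * Real.pi)) hj.1 (lt_min (by linarith) hj.2)
        (min_le_right _ _)
      rw [frequently_atTop] at h1 ⊢
      intro N
      obtain ⟨k, hk, hk'⟩ := h1 (N + 1)
      exact ⟨k - 1, by omega, by rwa [Nat.sub_add_cancel (by omega)]⟩
    obtain ⟨k, hk, hk1, hk2⟩ := (hvisit.and_eventually (hfreq.and hnear)).exists
    have hdir : φ (k + 1) j₀ ∈ S.radDirections ε (φ (k + 1)) (η k) := by
      rw [radDirections, if_pos (Set.not_nonempty_iff_eq_empty.1 hk1)]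
      exact ⟨j₀, rfl⟩
    obtain ⟨t, ht, ht'⟩ := ((hsteps k).1 (hklt k)).spec.2.2 _ hdir
    refine ht' (S.radFun_pos_iff.2 (hball (t, φ (k + 1) j₀) ?_))
    have := hk.2.trans_le (min_le_left _ _)
    have := ht.2.trans (hk' (k + 1))
    rw [Metric.mem_ball, Prod.dist_eq, max_lt_iff, Real.dist_eq, Real.dist_eq, abs_lt, abs_lt]
    refine ⟨⟨?_, ?_⟩, ?_, ?_⟩ <;> linarith [ht.1, hk.1]

end LTISystem

/-! ### ### Executability and convergence of both algorithms -/

theorem mainTheorem2 {n m p : ℕ} (hn : 0 < n) (S : LTISystem n m p) (hE : IsUnit S.E)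
    (ε : ℝ) (hε : 0 < ε) (hD : ε * ‖S.D‖ < 1) (Λ : Set ℂ) (hΛ : S.IsSelection Λ) :
    (IsGreatest (Complex.re '' S.svs ε) (S.abscissa ε) ∧
      ((∀ z ∈ S.eig, z ∉ Λ → IsIsolatedPoint (S.svs ε) z →
          ∃ w ∈ S.svs ε, (w ∈ Λ ∨ ¬ IsIsolatedPoint (S.svs ε) w) ∧ z.re ≤ w.re) →
        (∃ x, S.AbsInit ε Λ x) ∧
        (∀ x, ∃ x', S.AbsStep ε x x') ∧
        ∀ η : ℕ → ℝ, S.IsAbsRun ε Λ η → Tendsto η atTop (𝓝 (S.abscissa ε)))) ∧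
    (IsGreatest ((fun z : ℂ => ‖z‖) '' S.svs ε) (S.radius ε) ∧
      ((∀ z ∈ S.eig, z ∉ Λ → IsIsolatedPoint (S.svs ε) z →
          ∃ w ∈ S.svs ε, (w ∈ Λ ∨ ¬ IsIsolatedPoint (S.svs ε) w) ∧ ‖z‖ ≤ ‖w‖) →
        ∀ (q : ℕ), 0 < q →
        (∀ φ : Fin q → ℝ, ∃ x, S.RadInit ε Λ φ x) ∧
        (∀ (φ : Fin q → ℝ) (x : ℝ), ∃ x', S.RadStep ε φ x x') ∧
        ∀ (Ω : Type*) [MeasurableSpace Ω] (P : Measure Ω) [IsProbabilityMeasure P]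
          (φ : ℕ → Fin q → Ω → ℝ),
          (∀ k j, Measurable (φ k j)) →
          (∀ k j, pdf.IsUniform (φ k j) (Set.Ico 0 (2 * Real.pi)) P) →
          iIndepFun (fun kj : ℕ × Fin q => φ kj.1 kj.2) P →
          ∀ᵐ ω ∂P, ∀ η : ℕ → ℝ, S.IsRadRun ε Λ (fun k j => φ k j ω) η →
            Tendsto η atTop (𝓝 (S.radius ε)))) := by
  have hD' : ‖S.D‖ < ε⁻¹ := by
    rw [← mul_one ε⁻¹]; exact (lt_inv_mul_iff₀ hε).2 hD
  have hΛfin : Λ.Finite := (S.finite_eig hE).subset hΛ.1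
  refine ⟨⟨S.isGreatest_abscissa hn hE hε hD', fun hiso => ⟨?_, fun x => ?_, fun η hη =>
      S.tendsto_of_isAbsRun hn hE hε hD' hΛ hiso hη⟩⟩,
    S.isGreatest_radius hn hE hε hD', fun hiso q hq => ⟨fun φ => ?_, fun φ x => ?_, ?_⟩⟩
  · obtain ⟨z₀, hz₀, hmax⟩ := Set.exists_max_image Λ Complex.re hΛfin
      (S.nonempty_selection hn hE hε hD' hΛ Complex.continuous_re hiso)
    obtain ⟨x, hx⟩ := FastSearchSet.exists_of_roots (S.exists_root_horizFun hE hD')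
      (Set.finite_singleton z₀.im) z₀.re
    exact ⟨x, z₀, hz₀, hmax, hx⟩
  · by_cases h : x < S.abscissa ε
    · obtain ⟨x', hx'⟩ := FastSearchSet.exists_of_roots (S.exists_root_horizFun hE hD')
        (S.finite_vertMidpoints hE hε hD' x) x
      exact ⟨x', fun _ => hx', fun h' => absurd h h'⟩
    · exact ⟨x, fun h' => absurd h' h, fun _ => rfl⟩
  · obtain ⟨z₀, hz₀, hmax⟩ := Set.exists_max_image Λ (fun z : ℂ => ‖z‖) hΛfin
      (S.nonempty_selection hn hE hε hD' hΛ (f := fun z : ℂ => ‖z‖) continuous_norm hiso)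
    obtain ⟨x, hx⟩ := FastSearchSet.exists_of_roots (S.exists_root_radFun hE hD')
      ((Set.finite_range φ).insert z₀.arg) ‖z₀‖
    exact ⟨x, z₀, hz₀, hmax, hx⟩
  · by_cases h : x < S.radius ε
    · have hfin : (S.radDirections ε φ x).Finite := by
        rw [LTISystem.radDirections]
        split_ifs
        · exact Set.finite_range φ
        · exact S.finite_circMidpoints hε hD' x
      obtain ⟨x', hx'⟩ := FastSearchSet.exists_of_roots (S.exists_root_radFun hE hD') hfin x
      exact ⟨x', fun _ => hx', fun h' => absurd h h'⟩
    · exact ⟨x, fun h' => absurd h' h, fun _ => rfl⟩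
  · intro Ω _ P _ φ hmeas hunif hind
    have hind' : iIndepFun (fun k => φ k ⟨0, hq⟩) P :=
      hind.precomp (g := fun k : ℕ => (k, (⟨0, hq⟩ : Fin q))) fun a b h => congrArg Prod.fst h
    -- Rational endpoints leave countably many intervals, so one null set serves all intervals and
    -- hence all runs.
    have hae : ∀ᵐ ω ∂P, ∀ a b : ℚ, 0 ≤ (a : ℝ) → (a : ℝ) < b → (b : ℝ) ≤ 2 * Real.pi →
        ∃ᶠ k in atTop, φ k ⟨0, hq⟩ ω ∈ Set.Ioo (a : ℝ) b := by
      simp only [ae_all_iff]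
      intro a b ha hab hb
      exact ae_frequently_mem_Ioo_of_isUniform (fun k => hmeas k _) (fun k => hunif k _) hind'
        ha hab hb
    filter_upwards [hae] with ω hω η hη
    refine S.tendsto_of_isRadRun hn hE hε hD' hΛ hiso (j₀ := ⟨0, hq⟩) (fun a b ha hab hb => ?_) hη
    obtain ⟨a', ha1, ha2⟩ := exists_rat_btwn hab
    obtain ⟨b', hb1, hb2⟩ := exists_rat_btwn ha2
    exact (hω a' b' (ha.trans ha1.le) hb1 (hb2.le.trans hb)).mono fun k hk =>
      ⟨ha1.trans hk.1, hk.2.trans hb2⟩
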